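/- Let $n\ge 1$ and let $\Gamma\subset \mathrm{PGL}_{2n+2}(\mathbb C)$ be a subgroup, acting on $\mathbb P^{2n+1}=\mathbb P(\mathbb C^{2n+2})$. An $n$-plane is an $n$-dimensional projective linear subspace of $\mathbb P^{2n+1}$; for an $n$-plane $\ell$ let $\hat\ell\in\mathbb P(\Lambda^{n+1}\mathbb C^{2n+2})$ be the point given by its Plücker coordinates, and for $\sigma\in\mathrm{PGL}_{2n+2}(\mathbb C)$ let $\hat\sigma$ be the induced projective transformation of $\mathbb P(\Lambda^{n+1}\mathbb C^{2n+2})$. For a matrix $A$ let $|A|$ be the maximum of the absolute values of its entries. A sequence $\{\sigma_\nu\}$ of distinct elements of $\Gamma$ is called normal if $\sigma_\nu$ and $\hat\sigma_\nu$ have representing matrices $\tilde\sigma_\nu$ and $S_\nu$ (the latter in the standard basis of $\Lambda^{n+1}\mathbb C^{2n+2}$) with $|\tilde\sigma_\nu|=|S_\nu|=1$ such that both sequences of matrices converge; if $S=\lim_\nu S_\nu$, let $I(\{\hat\sigma_\nu\})\subset\mathbb P(\Lambda^{n+1}\mathbb C^{2n+2})$ be the projective subspace defined by the image of $S$. An $n$-plane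 $\ell$ is a limit $n$-plane of $\Gamma$ if $\hat\ell\in I(\{\hat\sigma_\nu\})$ for some normal sequence $\{\sigma_\nu\}$ of $\Gamma$. Let $\Lambda(\Gamma)$ be the union of all limit $n$-planes of $\Gamma$, and let $\Omega(\Gamma)=\mathbb P^{2n+1}\setminus\Lambda(\Gamma)$ be the set of discontinuity. The group $\Gamma$ is of type L if it is discrete and $\Omega(\Gamma)$ contains a large domain, that is, a connected open subset of $\mathbb P^{2n+1}$ which contains an $n$-plane. **Theorem.** Let $\Gamma$ be of type L. Then $\Omega(\Gamma)$ is open and $\Gamma$ acts properly discontinuously on it: $\gamma(\Omega(\Gamma))\subset\Omega(\Gamma)$ for every $\gamma\in\Gamma$, and for every compact set $M\subset\Omega(\Gamma)$ the set $\{\gamma\in\Gamma : \gamma(M)\cap M\neq\emptyset\}$ is finite. Hence the quotient space $X(\Gamma)=\Omega(\Gamma)/\Gamma$ is a good space in the following sense: it is Hausdorff, locally compact and second countable, and every $x\in\Omega(\Gamma)$ has a finite stabilizer $\Gamma_x$ in $\Gamma$ and an open neighbourhood $U\subset\Omega(\Gamma)$ with $\gamma(U)=U$ for $\gamma\in\Gamma_x$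 and $\gamma(U)\cap U=\emptyset$ for $\gamma\in\Gamma\setminus\Gamma_x$. -/

import Mathlib

open scoped LinearAlgebra.Projectivization

noncomputable section

namespace TypeL

/-- The projective space of dimension `k - 1` over the complex numbers. -/
abbrev PSpace (k : ℕ) : Type := ℙ ℂ (Fin k → ℂ)

/-- The group `PGL_k(ℂ)`; Mathlib provides its action on `PSpace k`. -/
abbrev PGLGroup (k : ℕ) : Type := Matrix.ProjGenLinGroup (Fin k) ℂ

/-- The usual (quotient) topology of the projective space. -/
instance instTopologicalSpacePSpace (k : ℕ) : TopologicalSpace (PSpace k) :=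
  TopologicalSpace.coinduced
    (fun v : {v : Fin k → ℂ // v ≠ 0} => Projectivization.mk ℂ v.1 v.2) inferInstance

/-- The usual (quotient) topology of `PGL_k(ℂ)`. -/
instance instTopologicalSpacePGLGroup (k : ℕ) : TopologicalSpace (PGLGroup k) :=
  TopologicalSpace.coinduced
    (Matrix.ProjGenLinGroup.mk : Matrix.GeneralLinearGroup (Fin k) ℂ →* PGLGroup k)
    inferInstance

/-- `A` is a matrix representing the projective transformation `σ`. -/
def Represents {k : ℕ} (A : Matrix (Fin k) (Fin k) ℂ) (σ : PGLGroup k) : Prop :=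
  ∃ g : Matrix.GeneralLinearGroup (Fin k) ℂ,
    Matrix.ProjGenLinGroup.mk g = σ ∧ (g : Matrix (Fin k) (Fin k) ℂ) = A

/-- Multiindices `i_1 < ... < i_m` in `{1, ..., k}`, as strictly increasing maps. -/
abbrev MultiIndex (m k : ℕ) : Type := Fin m ↪o Fin k

/-- The matrix of the `m`-th exterior power of `A` in the basis `e_{i_1} ∧ ... ∧ e_{i_m}`:
its entries are the `m × m` minors of `A`. -/
def compound (m : ℕ) {k : ℕ} (A : Matrix (Fin k) (Fin k) ℂ) :
    Matrix (MultiIndex m k) (MultiIndex m k) ℂ :=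
  Matrix.of fun K J => (A.submatrix K J).det

/-- `S` is a matrix representing the projective transformation induced by `σ` on the
projectivization of the `m`-th exterior power of `ℂ ^ k`. -/
def RepresentsHat (m : ℕ) {k : ℕ} (S : Matrix (MultiIndex m k) (MultiIndex m k) ℂ)
    (σ : PGLGroup k) : Prop :=
  ∃ A : Matrix (Fin k) (Fin k) ℂ, Represents A σ ∧ ∃ c : ℂ, c ≠ 0 ∧ S = c • compound m A

/-- The largest absolute value of an entry (the norm on the right is the sup norm of a finite
product, applied twice). -/
def maxEntry {ι : Type} [Fintype ι] (A : Matrix ι ι ℂ) : ℝ :=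
  ‖(Matrix.of.symm A : ι → ι → ℂ)‖

/-- The Plücker coordinates of the span of `x_1, ..., x_m` (for linearly independent vectors):
the `m × m` minors of the matrix with columns `x_1, ..., x_m`. -/
def plucker {m k : ℕ} (x : Fin m → (Fin k → ℂ)) : MultiIndex m k → ℂ :=
  fun K => (Matrix.of fun i j : Fin m => x j (K i)).det

/-- `σ` is a normal sequence of `Γ` and `S` is a limit of normalized representatives of the
induced sequence on the exterior power of order `n + 1`. The elements of the sequence are
distinct, and normalized representatives converge both in `PGL_{2n+2}(ℂ)` and on the exterior
power. (The induced transformations are then distinct too, as `PGL_{2n+2}(ℂ)` acts faithfully on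
the projectivized exterior power.) The limit image of the induced sequence is the projective
subspace defined by the range of `S`. -/
def IsNormalSequence (n : ℕ) (Γ : Subgroup (PGLGroup (2 * n + 2)))
    (σ : ℕ → PGLGroup (2 * n + 2))
    (S : Matrix (MultiIndex (n + 1) (2 * n + 2)) (MultiIndex (n + 1) (2 * n + 2)) ℂ) : Prop :=
  (∀ ν, σ ν ∈ Γ) ∧ Function.Injective σ ∧
  (∃ (A : ℕ → Matrix (Fin (2 * n + 2)) (Fin (2 * n + 2)) ℂ)
      (B : Matrix (Fin (2 * n + 2)) (Fin (2 * n + 2)) ℂ),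
    (∀ ν, Represents (A ν) (σ ν) ∧ maxEntry (A ν) = 1) ∧
      Filter.Tendsto A Filter.atTop (nhds B)) ∧
  (∃ T : ℕ → Matrix (MultiIndex (n + 1) (2 * n + 2)) (MultiIndex (n + 1) (2 * n + 2)) ℂ,
    (∀ ν, RepresentsHat (n + 1) (T ν) (σ ν) ∧ maxEntry (T ν) = 1) ∧
      Filter.Tendsto T Filter.atTop (nhds S))

/-- The points of the projective linear subspace defined by the vector subspace `L`. -/
def points {k : ℕ} (L : Submodule ℂ (Fin k → ℂ)) : Set (PSpace k) :=
  {p | p.submodule ≤ L}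

/-- `L` defines a limit `n`-plane of `Γ`: it is spanned by `n + 1` linearly independent vectors
whose Plücker coordinates define a point of the limit image of the sequence induced by some
normal sequence of `Γ`. -/
def IsLimitPlane (n : ℕ) (Γ : Subgroup (PGLGroup (2 * n + 2)))
    (L : Submodule ℂ (Fin (2 * n + 2) → ℂ)) : Prop :=
  ∃ (x : Fin (n + 1) → (Fin (2 * n + 2) → ℂ)) (σ : ℕ → PGLGroup (2 * n + 2))
    (S : Matrix (MultiIndex (n + 1) (2 * n + 2)) (MultiIndex (n + 1) (2 * n + 2)) ℂ),
    LinearIndependent ℂ x ∧ Submodule.span ℂ (Set.range x) = L ∧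
      IsNormalSequence n Γ σ S ∧ plucker x ∈ LinearMap.range S.mulVecLin

/-- The limit set: the union of the limit `n`-planes. -/
def limitSet (n : ℕ) (Γ : Subgroup (PGLGroup (2 * n + 2))) : Set (PSpace (2 * n + 2)) :=
  {p | ∃ L, IsLimitPlane n Γ L ∧ p ∈ points L}

/-- The set of discontinuity: the complement of the limit set. -/
def omegaSet (n : ℕ) (Γ : Subgroup (PGLGroup (2 * n + 2))) : Set (PSpace (2 * n + 2)) :=
  (limitSet n Γ)ᶜ

/-- A large domain: a connected open set that contains an `n`-plane. -/
def IsLargeDomain (n : ℕ) (W : Set (PSpace (2 * n + 2))) : Prop :=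
  IsOpen W ∧ IsConnected W ∧
    ∃ L : Submodule ℂ (Fin (2 * n + 2) → ℂ), Module.finrank ℂ L = n + 1 ∧ points L ⊆ W

/-- Groups of type L: discrete subgroups whose set of discontinuity contains a large domain. -/
def IsTypeL (n : ℕ) (Γ : Subgroup (PGLGroup (2 * n + 2))) : Prop :=
  DiscreteTopology Γ ∧ ∃ W, IsLargeDomain n W ∧ W ⊆ omegaSet n Γ

/-- `Γ` acts properly discontinuously on the set `D`: it maps `D` to itself, and for every compact
subset `M` of `D` only finitely many elements of `Γ` move `M` to a set that meets `M`. -/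
def ActsProperlyDiscontinuouslyOn {k : ℕ} (Γ : Subgroup (PGLGroup k)) (D : Set (PSpace k)) :
    Prop :=
  (∀ γ ∈ Γ, ∀ x ∈ D, γ • x ∈ D) ∧
    ∀ M ⊆ D, IsCompact M → {γ | γ ∈ Γ ∧ (((γ • ·) '' M) ∩ M).Nonempty}.Finite

/-- The quotient of the set of discontinuity by `Γ`, with the quotient topology: two points are
identified when some element of `Γ` maps one to the other. -/
abbrev XSpace (n : ℕ) (Γ : Subgroup (PGLGroup (2 * n + 2))) : Type :=
  Quotient ((MulAction.orbitRel Γ (PSpace (2 * n + 2))).comap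
    (Subtype.val : omegaSet n Γ → PSpace (2 * n + 2)))

/-- Locally on the open set `D`, the group `Γ` acts through finite groups: each point `x` of `D`
has a finite stabilizer and an open neighbourhood `U` in `D` that is preserved by the stabilizer
and moved off itself by all the other elements of `Γ`. -/
def HasFiniteSlices {k : ℕ} (Γ : Subgroup (PGLGroup k)) (D : Set (PSpace k)) : Prop :=
  ∀ x ∈ D, {γ | γ ∈ Γ ∧ γ • x = x}.Finite ∧
    ∃ U ⊆ D, IsOpen U ∧ x ∈ U ∧ ∀ γ ∈ Γ,
      (γ • x = x → (γ • ·) '' U = U) ∧ (γ • x ≠ x → Disjoint ((γ • ·) '' U) U)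

end TypeL

end

/-! Write each σ ∈ Γ as U·D·V with U, V unitary and D diagonal with decreasing positive entries d.
On the exterior power, σ̂ is, up to a scalar, Λ(U)·diag(w)·Λ(V), where the weight w_K is the product
of the d at the indices in K divided by the product of the n + 1 largest. All weights lie in [0, 1],
and the first multiindex has weight 1. As the unitary group is compact, U, V and w converge along a
subsequence, so the limit matrix of a normal sequence is S = c·Λ(U₀)·diag(e)·Λ(V₀) with c ≠ 0
(`IsNormalSequence.exists_limit_svd`).

The crux is that S has rank one (`IsNormalSequence.weight_limit_secondIndex_eq_zero`). If the second
largest weight d_{n+1}/d_n did not tend to 0, the image of S would contain a line of Plücker points,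
those of the pencil of n-planes U₀⟨e_0, …, e_{n-1}, αe_n + βe_{n+1}⟩. These sweep out a projective
subspace of dimension n + 1, which meets every n-plane of ℙ^{2n+1}, in particular the one contained
in Ω(Γ): a contradiction. Since the second weight bounds all later ones, only the first survives,
and the normal sequence has a single limit plane, the attracting plane U₀⟨e_0, …, e_n⟩.

Hence the limit set is the union of the planes U⟨e_0, …, e_n⟩ over the accumulation points U of the
left factors (`proj_mem_limitSet_iff`). These U form a compact set, so the limit set is closed. For
proper discontinuity, suppose infinitely many σ_ν carry points v_ν of a compact M to points w_ν of
M. Since d_{n+1}/d_n → 0, in the limit either w₀ lies on the attracting plane of the σ_ν or v₀ lies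
on their repelling plane, which is the attracting plane of the inverses (`finite_of_isCompact`).
Both are limit planes, so M would meet the limit set. The statements on the quotient follow by
general topology. -/

noncomputable section

namespace TypeL

open Matrix Equiv Function

/-! ### Minors and the Cauchy–Binet formula -/

section Minors

variable {R : Type*} [CommRing R] {m k : ℕ}

/-- An injective map between finite ordinals is an increasing map up to a permutation. -/
lemma exists_eq_orderEmbedding_comp_perm {f : Fin m → Fin k} (hf : Injective f) :
    ∃ (K : Fin m ↪o Fin k) (π : Perm (Fin m)), f = K ∘ π := by
  have hmono : StrictMono (f ∘ Tuple.sort f) :=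
    (Tuple.monotone_sort f).strictMono_of_injective (hf.comp (Tuple.sort f).injective)
  refine ⟨OrderEmbedding.ofStrictMono _ hmono, (Tuple.sort f)⁻¹, ?_⟩
  funext i
  simp

lemma orderEmbedding_ext_range {K J : Fin m ↪o Fin k} (h : Set.range K = Set.range J) : K = J :=
  OrderEmbedding.range_inj.1 h

lemma exists_notMem_range_of_ne {K J : Fin m ↪o Fin k} (h : K ≠ J) :
    ∃ i, K i ∉ Set.range J := by
  by_contra! hc
  refine h (orderEmbedding_ext_range ?_)
  have hsub : Set.range K ⊆ Set.range J := by
    rintro _ ⟨i, rfl⟩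
    exact hc i
  refine Set.eq_of_subset_of_ncard_le hsub ?_ (Set.finite_range _)
  rw [← Set.image_univ, ← Set.image_univ, Set.ncard_image_of_injective _ K.injective,
    Set.ncard_image_of_injective _ J.injective]

lemma det_submatrix_eq_zero_of_not_injective (Y : Matrix (Fin k) (Fin m) R) {f : Fin m → Fin k}
    (hf : ¬ Injective f) : (Y.submatrix f id).det = 0 := by
  simp only [Injective, not_forall] at hf
  obtain ⟨i, j, hij, hne⟩ := hf
  exact det_zero_of_row_eq hne (by ext a; simp [hij])

/-- Each row of X * Y is a combination of the rows of Y, and the determinant is multilinear in the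
rows. -/
lemma det_mul_eq_sum_functions (X : Matrix (Fin m) (Fin k) R) (Y : Matrix (Fin k) (Fin m) R) :
    (X * Y).det = ∑ p : Fin m → Fin k, (∏ i, X i (p i)) * (Y.submatrix p id).det := by
  have hrow : (X * Y : Matrix _ _ R) = fun i => ∑ a, X i a • Y a := by
    funext i j
    simp [mul_apply]
  have h := (detRowAlternating (n := Fin m) (R := R)).toMultilinearMap.map_sum
    (fun (i : Fin m) (a : Fin k) => X i a • Y a)
  rw [hrow]
  refine h.trans (Finset.sum_congr rfl fun p _ => ?_)
  exact (detRowAlternating (n := Fin m) (R := R)).toMultilinearMap.map_smul_univ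
    (fun i => X i (p i)) (fun i => Y (p i))

/-- The Cauchy-Binet formula. -/
theorem det_mul_eq_sum_minors (X : Matrix (Fin m) (Fin k) R) (Y : Matrix (Fin k) (Fin m) R) :
    (X * Y).det =
      ∑ K : Fin m ↪o Fin k, (X.submatrix id K).det * (Y.submatrix K id).det := by
  classical
  rw [det_mul_eq_sum_functions]
  rw [← Finset.sum_subset (Finset.filter_subset (fun p => Injective p) Finset.univ)
    (fun p _ hp => by
      rw [det_submatrix_eq_zero_of_not_injective Y (by simpa using hp), mul_zero])]
  -- Injective index maps factor uniquely as K ∘ π. Leibniz expansion of the X-minor gives the sum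
  -- over π, and its signs are absorbed by permuting the rows of the Y-minor.
  have hterm : ∀ K : Fin m ↪o Fin k, (X.submatrix id K).det * (Y.submatrix K id).det =
      ∑ π : Perm (Fin m), (∏ i, X i (K (π i))) * (Y.submatrix (K ∘ π) id).det := by
    intro K
    rw [← det_transpose, det_apply', Finset.sum_mul]
    refine Finset.sum_congr rfl fun π _ => ?_
    have := det_permute π (Y.submatrix K id)
    rw [submatrix_submatrix] at this
    simp only [id_comp] at this
    rw [this]
    simp only [transpose_apply, submatrix_apply, id_eq]
    ring
  simp_rw [hterm]
  rw [← Finset.sum_product']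
  symm
  refine Finset.sum_bij (fun x _ => x.1 ∘ x.2) ?_ ?_ ?_ ?_
  · rintro ⟨K, π⟩ -
    simpa using K.injective.comp π.injective
  · rintro ⟨K, π⟩ - ⟨J, τ⟩ - h
    have h' : (K ∘ π : Fin m → Fin k) = J ∘ τ := h
    have hKJ : K = J := by
      refine orderEmbedding_ext_range ?_
      rw [← π.surjective.range_comp K, h', τ.surjective.range_comp]
    subst hKJ
    refine Prod.ext rfl (Equiv.ext fun i => K.injective (congrFun h' i))
  · intro p hp
    obtain ⟨K, π, rfl⟩ := exists_eq_orderEmbedding_comp_perm (Finset.mem_filter.1 hp).2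
    exact ⟨(K, π), Finset.mem_product.2 ⟨Finset.mem_univ _, Finset.mem_univ _⟩, rfl⟩
  · rintro ⟨K, π⟩ -
    rfl

end Minors

/-! ### Exterior powers of matrices and Plücker coordinates -/

section Compound

variable {m k : ℕ}

lemma compound_mul (A B : Matrix (Fin k) (Fin k) ℂ) :
    compound m (A * B) = compound m A * compound m B := by
  ext K J
  simp only [compound, of_apply, mul_apply (M := of _)]
  have h : (A * B).submatrix K J = A.submatrix K id * B.submatrix id J := by
    ext i j
    simp [mul_apply]
  rw [h, det_mul_eq_sum_minors]
  rfl

lemma det_diagonal_mul_submatrix (d : Fin k → ℂ) (K J : MultiIndex m k) :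
    ((diagonal d).submatrix K J).det = (∏ i, d (K i)) * ((1 : Matrix _ _ ℂ).submatrix K J).det := by
  rw [← det_diagonal, ← det_mul]
  congr 1
  ext i j
  simp [diagonal_mul, diagonal_apply, one_apply]

lemma det_one_submatrix (K J : MultiIndex m k) :
    ((1 : Matrix (Fin k) (Fin k) ℂ).submatrix K J).det = if K = J then 1 else 0 := by
  split_ifs with h
  · subst h
    rw [submatrix_one _ K.injective, det_one]
  · obtain ⟨i, hi⟩ := exists_notMem_range_of_ne h
    refine det_eq_zero_of_row_eq_zero i fun j => ?_
    rw [submatrix_apply, one_apply_ne]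
    exact fun hj => hi ⟨j, hj.symm⟩

lemma compound_diagonal (d : Fin k → ℂ) :
    compound m (diagonal d) = diagonal fun K => ∏ i, d (K i) := by
  ext K J
  rw [compound, of_apply, det_diagonal_mul_submatrix, det_one_submatrix, diagonal_apply]
  simp

lemma compound_one : compound m (1 : Matrix (Fin k) (Fin k) ℂ) = 1 := by
  ext K J
  rw [compound, of_apply, det_one_submatrix, one_apply]

lemma compound_smul (a : ℂ) (A : Matrix (Fin k) (Fin k) ℂ) :
    compound m (a • A) = a ^ m • compound m A := by
  ext K J
  rw [Matrix.smul_apply, compound, of_apply, compound, of_apply, submatrix_smul, Pi.smul_apply,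
    Pi.smul_apply, det_smul, Fintype.card_fin, smul_eq_mul]

lemma continuous_compound :
    Continuous (compound m : Matrix (Fin k) (Fin k) ℂ → Matrix (MultiIndex m k) _ ℂ) := by
  refine continuous_matrix fun K J => ?_
  exact (continuous_id.matrix_submatrix _ _).matrix_det

lemma plucker_mulVec (A : Matrix (Fin k) (Fin k) ℂ) (x : Fin m → Fin k → ℂ) :
    plucker (fun j => A *ᵥ x j) = compound m A *ᵥ plucker x := by
  funext K
  have h : (of fun i j : Fin m => (A *ᵥ x j) (K i)) =
      A.submatrix K id * (of fun a j => x j a : Matrix (Fin k) (Fin m) ℂ) := by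
    ext i j
    simp [mul_apply, mulVec, dotProduct]
  simp only [plucker, h, det_mul_eq_sum_minors]
  rfl

lemma plucker_single (J : MultiIndex m k) :
    plucker (fun j => Pi.single (J j) (1 : ℂ)) = Pi.single J 1 := by
  funext K
  have h : (of fun i j : Fin m => (Pi.single (J j) (1 : ℂ) : Fin k → ℂ) (K i)) =
      (1 : Matrix (Fin k) (Fin k) ℂ).submatrix K J := by
    ext i j
    simp [one_apply, Pi.single_apply]
  rw [plucker, h, det_one_submatrix, Pi.single_apply]

lemma plucker_eq_det_submatrix (x : Fin m → Fin k → ℂ) (K : MultiIndex m k) :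
    plucker x K = ((of fun a j => x j a : Matrix (Fin k) (Fin m) ℂ).submatrix K id).det := rfl

/-- The matrix Y of the vectors has a left inverse X; if all minors of Y vanished, Cauchy–Binet
would give 1 = det (X * Y) = 0. -/
lemma plucker_ne_zero {x : Fin m → Fin k → ℂ} (hx : LinearIndependent ℂ x) : plucker x ≠ 0 := by
  intro h0
  set Y : Matrix (Fin k) (Fin m) ℂ := of fun a j => x j a with hY
  have hinj : Function.Injective Y.mulVec := mulVec_injective_iff.2 hx
  obtain ⟨X, hX⟩ : ∃ X : Matrix (Fin m) (Fin k) ℂ, X * Y = 1 := by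
    obtain ⟨g, hg⟩ := LinearMap.exists_leftInverse_of_injective Y.mulVecLin
      (LinearMap.ker_eq_bot.2 hinj)
    refine ⟨LinearMap.toMatrix' g, ?_⟩
    have := congrArg LinearMap.toMatrix' hg
    rwa [LinearMap.toMatrix'_comp, ← Matrix.toLin'_apply', LinearMap.toMatrix'_toLin',
      LinearMap.toMatrix'_id] at this
  have := det_mul_eq_sum_minors X Y
  rw [hX, det_one] at this
  refine one_ne_zero (this.trans (Finset.sum_eq_zero fun K _ => ?_))
  have hK := congrFun h0 K
  rw [plucker_eq_det_submatrix, ← hY] at hK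
  rw [hK, Pi.zero_apply, mul_zero]

/-- If the Plücker coordinates of linearly independent vectors vanish except for the one at `J`,
then the vectors lie in the coordinate subspace of `J`. -/
lemma apply_eq_zero_of_plucker_eq_single {x : Fin m → Fin k → ℂ} (hx : LinearIndependent ℂ x)
    {J : MultiIndex m k} {s : ℂ} (hs : plucker x = s • Pi.single J 1) {a : Fin k}
    (ha : a ∉ Set.range J) (i : Fin m) : x i a = 0 := by
  set Y : Matrix (Fin k) (Fin m) ℂ := of fun a j => x j a with hY
  -- A minor that uses row a is zero or, up to sign, a Plücker coordinate at a multiindex other than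
  -- J.
  have hzero : ∀ f : Fin m → Fin k, a ∈ Set.range f → (Y.submatrix f id).det = 0 := by
    intro f hf
    by_cases hinj : Injective f
    · obtain ⟨K, π, rfl⟩ := exists_eq_orderEmbedding_comp_perm hinj
      have hKJ : K ≠ J := by
        rintro rfl
        rw [π.surjective.range_comp] at hf
        exact ha hf
      have hp := det_permute π (Y.submatrix K id)
      rw [submatrix_submatrix, id_comp] at hp
      rw [hp, hY, ← plucker_eq_det_submatrix, hs]
      simp [hKJ]
    · exact det_submatrix_eq_zero_of_not_injective Y hinj
  have hdet : (Y.submatrix J id).det ≠ 0 := by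
    intro h0
    refine plucker_ne_zero hx ?_
    have : plucker x J = s := by simp [hs]
    rw [plucker_eq_det_submatrix, ← hY, h0] at this
    rw [hs, ← this, zero_smul]
  -- By Cramer's rule row a is a combination of the rows in J, with numerators the J-minors in which
  -- one row is replaced by row a.
  have hcramer : cramer (Y.submatrix J id)ᵀ (Y a) = 0 := by
    funext i
    rw [cramer_transpose_apply, Pi.zero_apply, ← hzero (update J i a) ⟨i, by simp⟩]
    congr 1
    ext b c
    rcases eq_or_ne b i with rfl | hb <;> simp [updateRow_apply, *]
  have h := mulVec_cramer (Y.submatrix J id)ᵀ (Y a)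
  rw [hcramer, mulVec_zero, det_transpose] at h
  have := congrFun ((smul_eq_zero.1 h.symm).resolve_left hdet) i
  exact this

end Compound

/-! ### Singular value decomposition -/

section SingularValueDecomposition

variable {ι : Type*} [Fintype ι] [DecidableEq ι]

lemma isCompact_unitaryGroup : IsCompact (unitaryGroup ι ℂ : Set (Matrix ι ι ℂ)) := by
  refine IsCompact.of_isClosed_subset
    (s := Set.pi Set.univ fun _ => Set.pi Set.univ fun _ => Metric.closedBall (0 : ℂ) 1)
    (isCompact_univ_pi fun _ => isCompact_univ_pi fun _ => isCompact_closedBall _ _) ?_ ?_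
  · exact isClosed_unitary (R := Matrix ι ι ℂ)
  · intro U hU i _ j _
    simpa using entry_norm_bound_of_unitary hU i j

open scoped ComplexOrder in
/-- The singular value decomposition of an invertible complex matrix. -/
theorem exists_singular_decomposition {k : ℕ} (A : Matrix (Fin k) (Fin k) ℂ) (hA : IsUnit A) :
    ∃ U ∈ unitaryGroup (Fin k) ℂ, ∃ V ∈ unitaryGroup (Fin k) ℂ, ∃ d : Fin k → ℝ,
      Antitone d ∧ (∀ i, 0 < d i) ∧ A = U * diagonal (fun i => (d i : ℂ)) * V := by
  have hpos : (Aᴴ * A).PosDef := PosDef.conjTranspose_mul_self A (mulVec_injective_of_isUnit hA)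
  set W₀ := (hpos.1.eigenvectorUnitary : Matrix (Fin k) (Fin k) ℂ) with hW₀
  have hW₀u : W₀ᴴ * W₀ = 1 := by
    have := hpos.1.eigenvectorUnitary.2
    exact mem_unitaryGroup_iff'.1 this
  set ev := hpos.1.eigenvalues
  have hspec : W₀ᴴ * (Aᴴ * A) * W₀ = diagonal fun i => (ev i : ℂ) := by
    have := hpos.1.conjStarAlgAut_star_eigenvectorUnitary
    rw [Unitary.conjStarAlgAut_star_apply] at this
    exact this
  -- Sorting the negated eigenvalues makes the singular values decreasing.
  set π : Perm (Fin k) := Tuple.sort (fun i => - ev i)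
  have hmono : Monotone ((fun i => - ev i) ∘ π) := Tuple.monotone_sort _
  set W := W₀.submatrix id π
  have hWu : Wᴴ * W = 1 := by
    have : Wᴴ * W = (W₀ᴴ * W₀).submatrix π π := by
      ext i j; simp [W, mul_apply]
    rw [this, hW₀u, submatrix_one_equiv]
  have hWs : Wᴴ * (Aᴴ * A) * W = diagonal fun i => (ev (π i) : ℂ) := by
    have : Wᴴ * (Aᴴ * A) * W = (W₀ᴴ * (Aᴴ * A) * W₀).submatrix π π := by
      ext i j; simp [W, mul_apply]
    rw [this, hspec, submatrix_diagonal_equiv]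
    rfl
  have hevpos : ∀ i, 0 < ev i := hpos.eigenvalues_pos
  set d : Fin k → ℝ := fun i => √(ev (π i))
  have hd : ∀ i, 0 < d i := fun i => Real.sqrt_pos.2 (hevpos _)
  have hdC : ∀ i, (d i : ℂ) ≠ 0 := fun i => Complex.ofReal_ne_zero.2 (hd i).ne'
  have hdd : ∀ i, (ev (π i) : ℂ) = d i * d i := fun i => by
    rw [← Complex.ofReal_mul, Real.mul_self_sqrt (hevpos _).le]
  set E : Matrix (Fin k) (Fin k) ℂ := diagonal fun i => (d i : ℂ)⁻¹
  have hEH : Eᴴ = E := by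
    rw [diagonal_conjTranspose]
    congr 1
    funext i
    simp
  have hWW : W * Wᴴ = 1 := mul_eq_one_comm.1 hWu
  -- The columns of A * W are orthogonal with lengths d i, so rescaling them by E = D⁻¹ gives a
  -- unitary left factor.
  refine ⟨A * W * E, ?_, Wᴴ, ?_, d, ?_, hd, ?_⟩
  · rw [mem_unitaryGroup_iff', star_eq_conjTranspose, conjTranspose_mul, conjTranspose_mul, hEH]
    calc E * (Wᴴ * Aᴴ) * (A * W * E) = E * (Wᴴ * (Aᴴ * A) * W) * E := by
          simp only [Matrix.mul_assoc]
      _ = 1 := by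
          rw [hWs, diagonal_mul_diagonal, diagonal_mul_diagonal, ← diagonal_one]
          congr 1
          funext i
          rw [hdd]
          field_simp [hdC i]
  · rw [mem_unitaryGroup_iff', star_eq_conjTranspose, conjTranspose_conjTranspose, hWW]
  · intro i j hij
    exact Real.sqrt_le_sqrt (neg_le_neg_iff.1 (hmono hij))
  · have hE : E * diagonal (fun i => (d i : ℂ)) = 1 := by
      rw [diagonal_mul_diagonal, ← diagonal_one]
      congr 1
      funext i
      exact inv_mul_cancel₀ (hdC i)
    rw [Matrix.mul_assoc (A * W), hE, Matrix.mul_one, Matrix.mul_assoc, hWW, Matrix.mul_one]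

end SingularValueDecomposition

end TypeL
end

noncomputable section

namespace TypeL

open Matrix Function

/-! ### Topology of projective space -/

section ProjectiveSpace

variable {k : ℕ}

/-- The quotient map from the nonzero vectors to the projective space. -/
def proj (k : ℕ) (v : {v : Fin k → ℂ // v ≠ 0}) : PSpace k := Projectivization.mk ℂ v.1 v.2

/-- Proportionality as vanishing of 2 × 2 minors: a closed condition, which makes the quotient
Hausdorff. -/
lemma proj_eq_iff {v w : {v : Fin k → ℂ // v ≠ 0}} :
    proj k v = proj k w ↔ ∀ i j, v.1 i * w.1 j = v.1 j * w.1 i := by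
  rw [proj, proj, Projectivization.mk_eq_mk_iff']
  constructor
  · rintro ⟨a, ha⟩ i j
    rw [← ha]
    simp only [Pi.smul_apply, smul_eq_mul]
    ring
  · intro h
    obtain ⟨j, hj⟩ := Function.ne_iff.1 w.2
    have hj : w.1 j ≠ 0 := hj
    refine ⟨v.1 j / w.1 j, funext fun i => ?_⟩
    rw [Pi.smul_apply, smul_eq_mul, div_mul_eq_mul_div, div_eq_iff hj, h]

/-- Rescaling the nonzero vectors. -/
def rescale (a : ℂˣ) : {v : Fin k → ℂ // v ≠ 0} ≃ₜ {v : Fin k → ℂ // v ≠ 0} :=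
  (Homeomorph.smul a).subtype fun v => by
    simp [Units.smul_def]

lemma proj_eq_iff_rescale {v w : {v : Fin k → ℂ // v ≠ 0}} :
    proj k v = proj k w ↔ ∃ a, rescale a w = v := by
  rw [proj, proj, Projectivization.mk_eq_mk_iff]
  exact exists_congr fun a => ⟨fun h => Subtype.ext h, fun h => congrArg Subtype.val h⟩

lemma isOpenQuotientMap_proj : IsOpenQuotientMap (proj k) := by
  refine ⟨?_, continuous_coinduced_rng, ?_⟩
  · intro p
    induction p using Projectivization.ind with
    | h v hv => exact ⟨⟨v, hv⟩, rfl⟩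
  · intro U hU
    refine isOpen_coinduced.2 ?_
    have : proj k ⁻¹' (proj k '' U) = ⋃ a : ℂˣ, rescale a ⁻¹' U := by
      ext v
      simp only [Set.mem_preimage, Set.mem_image, Set.mem_iUnion]
      constructor
      · rintro ⟨w, hw, h⟩
        obtain ⟨a, rfl⟩ := proj_eq_iff_rescale.1 h
        exact ⟨a, hw⟩
      · rintro ⟨a, ha⟩
        exact ⟨_, ha, proj_eq_iff_rescale.2 ⟨a, rfl⟩⟩
    change IsOpen (proj k ⁻¹' (proj k '' U))
    rw [this]
    exact isOpen_iUnion fun a => hU.preimage (rescale a).continuous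

instance : T2Space (PSpace k) := by
  rw [t2Space_iff_of_isOpenQuotientMap isOpenQuotientMap_proj]
  have : {q : {v : Fin k → ℂ // v ≠ 0} × {v : Fin k → ℂ // v ≠ 0} | proj k q.1 = proj k q.2} =
      ⋂ i, ⋂ j, {q | q.1.1 i * q.2.1 j = q.1.1 j * q.2.1 i} := by
    ext q
    simp [proj_eq_iff]
  rw [this]
  have hfst : ∀ i, Continuous fun q : {v : Fin k → ℂ // v ≠ 0} × {v : Fin k → ℂ // v ≠ 0} =>
      q.1.1 i := fun i => (continuous_apply i).comp (continuous_subtype_val.comp continuous_fst)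
  have hsnd : ∀ i, Continuous fun q : {v : Fin k → ℂ // v ≠ 0} × {v : Fin k → ℂ // v ≠ 0} =>
      q.2.1 i := fun i => (continuous_apply i).comp (continuous_subtype_val.comp continuous_snd)
  exact isClosed_iInter fun i => isClosed_iInter fun j =>
    isClosed_eq ((hfst i).mul (hsnd j)) ((hfst j).mul (hsnd i))

instance : SecondCountableTopology (PSpace k) :=
  isOpenQuotientMap_proj.isQuotientMap.secondCountableTopology isOpenQuotientMap_proj.isOpenMap

/-- The nonzero vector underlying a vector of the unit sphere. -/
def sphereInclusion (k : ℕ) (v : Metric.sphere (0 : Fin k → ℂ) 1) : {v : Fin k → ℂ // v ≠ 0} :=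
  ⟨v.1, ne_zero_of_mem_unit_sphere v⟩

lemma continuous_sphereInclusion : Continuous (sphereInclusion k) := by
  unfold sphereInclusion
  fun_prop

lemma surjective_proj_sphere : Surjective (proj k ∘ sphereInclusion k) := by
  intro p
  obtain ⟨v, rfl⟩ := isOpenQuotientMap_proj.surjective p
  have hv : ‖v.1‖ ≠ 0 := norm_ne_zero_iff.2 v.2
  refine ⟨⟨((‖v.1‖ : ℂ)⁻¹) • v.1, ?_⟩, ?_⟩
  · simp [norm_smul, hv]
  · refine (Projectivization.mk_eq_mk_iff' ..).2 ⟨(‖v.1‖ : ℂ)⁻¹, rfl⟩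

lemma continuous_proj_sphere : Continuous (proj k ∘ sphereInclusion k) :=
  isOpenQuotientMap_proj.continuous.comp continuous_sphereInclusion

instance : CompactSpace (PSpace k) :=
  surjective_proj_sphere.compactSpace continuous_proj_sphere

lemma mk_smul_proj (g : GeneralLinearGroup (Fin k) ℂ) (v : {v : Fin k → ℂ // v ≠ 0}) :
    ∃ h : (g : Matrix (Fin k) (Fin k) ℂ) *ᵥ v.1 ≠ 0,
      (ProjGenLinGroup.mk g : PGLGroup k) • proj k v = proj k ⟨_, h⟩ :=
  ⟨(smul_ne_zero_iff_ne g).2 v.2, rfl⟩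

instance : ContinuousConstSMul (PGLGroup k) (PSpace k) where
  continuous_const_smul γ := by
    induction γ using ProjGenLinGroup.induction_on with
    | mk g =>
      rw [isOpenQuotientMap_proj.isQuotientMap.continuous_iff]
      choose h hh using fun v => mk_smul_proj g v
      have : (fun p : PSpace k => (ProjGenLinGroup.mk g : PGLGroup k) • p) ∘ proj k =
          proj k ∘ fun v => ⟨_, h v⟩ := funext hh
      rw [this]
      exact isOpenQuotientMap_proj.continuous.comp
        (Continuous.subtype_mk (continuous_const.matrix_mulVec continuous_subtype_val) _)

lemma proj_mem_points {L : Submodule ℂ (Fin k → ℂ)} {v : {v : Fin k → ℂ // v ≠ 0}} :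
    proj k v ∈ points L ↔ v.1 ∈ L := by
  rw [points, Set.mem_ofPred_eq, proj, Projectivization.submodule_mk,
    Submodule.span_singleton_le_iff_mem]

end ProjectiveSpace

/-! ### Quotients and slices of properly discontinuous actions -/

section ProperlyDiscontinuous

variable {k : ℕ} {Γ : Subgroup (PGLGroup k)} {D : Set (PSpace k)}

/-- The action of a group on an invariant set. -/
@[reducible]
def actionOn (hD : ∀ γ ∈ Γ, ∀ x ∈ D, γ • x ∈ D) : MulAction Γ D where
  smul γ x := ⟨γ • x.1, hD γ.1 γ.2 x.1 x.2⟩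
  one_smul x := Subtype.ext (one_smul Γ x.1)
  mul_smul a b x := Subtype.ext (mul_smul a b x.1)

lemma continuousConstSMul_actionOn (hD : ∀ γ ∈ Γ, ∀ x ∈ D, γ • x ∈ D) :
    letI := actionOn hD
    ContinuousConstSMul Γ D := by
  let := actionOn hD
  exact ⟨fun γ => Continuous.subtype_mk
    ((continuous_const_smul (γ : PGLGroup k)).comp continuous_subtype_val) _⟩

lemma ActsProperlyDiscontinuouslyOn.properlyDiscontinuousSMul
    (h : ActsProperlyDiscontinuouslyOn Γ D) :
    letI := actionOn h.1
    ProperlyDiscontinuousSMul Γ D := by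
  let := actionOn h.1
  refine ⟨fun {K L} hK hL => ?_⟩
  -- Applying the one-set condition to K ∪ L covers the two-set condition.
  have hfin := h.2 (Subtype.val '' (K ∪ L)) (by simp) ((hK.union hL).image continuous_subtype_val)
  refine (hfin.preimage Subtype.val_injective.injOn (f := ((↑) : Γ → PGLGroup k))).subset ?_
  rintro γ ⟨_, ⟨x, hx, rfl⟩, hL'⟩
  exact ⟨γ.2, γ • x.1, ⟨x.1, ⟨x, Or.inl hx, rfl⟩, rfl⟩, ⟨_, Or.inr hL', rfl⟩⟩

lemma comap_orbitRel_eq (hD : ∀ γ ∈ Γ, ∀ x ∈ D, γ • x ∈ D) :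
    letI := actionOn hD
    (MulAction.orbitRel Γ (PSpace k)).comap (Subtype.val : D → PSpace k) =
      MulAction.orbitRel Γ D := by
  let := actionOn hD
  refine Setoid.ext fun x y => ?_
  simp only [Setoid.comap_rel, MulAction.orbitRel_apply, MulAction.mem_orbit_iff]
  exact exists_congr fun γ => ⟨fun h => Subtype.ext h, fun h => congrArg Subtype.val h⟩

/-- The quotient of an open set by a properly discontinuous action is Hausdorff, locally compact
and second countable. -/
theorem ActsProperlyDiscontinuouslyOn.quotient (h : ActsProperlyDiscontinuouslyOn Γ D)
    (hopen : IsOpen D) :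
    T2Space (Quotient ((MulAction.orbitRel Γ (PSpace k)).comap (Subtype.val : D → PSpace k))) ∧
    LocallyCompactSpace
      (Quotient ((MulAction.orbitRel Γ (PSpace k)).comap (Subtype.val : D → PSpace k))) ∧
    SecondCountableTopology
      (Quotient ((MulAction.orbitRel Γ (PSpace k)).comap (Subtype.val : D → PSpace k))) := by
  let := actionOn h.1
  have := continuousConstSMul_actionOn h.1
  have := h.properlyDiscontinuousSMul
  have : LocallyCompactSpace D := hopen.locallyCompactSpace
  rw [comap_orbitRel_eq h.1]
  have hq : IsOpenQuotientMap (Quotient.mk (MulAction.orbitRel Γ D)) :=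
    MulAction.isOpenQuotientMap_quotientMk
  exact ⟨inferInstance, hq.locallyCompactSpace,
    hq.isQuotientMap.secondCountableTopology hq.isOpenMap⟩

theorem ActsProperlyDiscontinuouslyOn.hasFiniteSlices (h : ActsProperlyDiscontinuouslyOn Γ D)
    (hopen : IsOpen D) : HasFiniteSlices Γ D := by
  let := actionOn h.1
  have := continuousConstSMul_actionOn h.1
  have := h.properlyDiscontinuousSMul
  have : LocallyCompactSpace D := hopen.locallyCompactSpace
  intro x hx
  have hfin : {γ | γ ∈ Γ ∧ γ • x = x}.Finite := by
    refine (h.2 {x} (by simpa) isCompact_singleton).subset ?_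
    rintro γ ⟨hγ, hγx⟩
    exact ⟨hγ, by simpa using hγx.symm⟩
  refine ⟨hfin, ?_⟩
  obtain ⟨W, hW, hWd⟩ :=
    ProperlyDiscontinuousSMul.exists_nhds_disjoint_image Γ (⟨x, hx⟩ : D)
  obtain ⟨W₀, hW₀W, hW₀o, hxW₀⟩ := mem_nhds_iff.1 hW
  set N : Set (PSpace k) := Subtype.val '' W₀ with hN
  have hNo : IsOpen N := hopen.isOpenMap_subtype_val _ hW₀o
  -- Intersecting the translates of N over the finite stabilizer makes the neighbourhood invariant
  -- and keeps it open.
  set U : Set (PSpace k) := ⋂ γ ∈ {γ | γ ∈ Γ ∧ γ • x = x}, (γ • ·) ⁻¹' N with hU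
  have hUN : U ⊆ N := fun y hy => by
    have := Set.mem_iInter₂.1 hy 1 ⟨Γ.one_mem, one_smul _ x⟩
    simpa using this
  have hmaps : ∀ γ ∈ Γ, γ • x = x → ∀ y ∈ U, γ • y ∈ U := by
    intro γ hγ hγx y hy
    refine Set.mem_iInter₂.2 fun δ hδ => ?_
    have := Set.mem_iInter₂.1 hy (δ * γ) ⟨Γ.mul_mem hδ.1 hγ, by rw [mul_smul, hγx, hδ.2]⟩
    simpa [mul_smul] using this
  refine ⟨U, ?_, ?_, ?_, ?_⟩
  · intro y hy
    obtain ⟨z, -, rfl⟩ := hUN hy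
    exact z.2
  · exact hfin.isOpen_biInter fun γ _ => hNo.preimage (continuous_const_smul γ)
  · refine Set.mem_iInter₂.2 fun γ hγ => ?_
    rw [Set.mem_preimage, hγ.2]
    exact ⟨_, hxW₀, rfl⟩
  · intro γ hγ
    constructor
    · intro hγx
      refine Set.Subset.antisymm (Set.image_subset_iff.2 (hmaps γ hγ hγx)) fun y hy => ?_
      refine ⟨γ⁻¹ • y, hmaps _ (Γ.inv_mem hγ) (inv_smul_eq_iff.2 hγx.symm) y hy, ?_⟩
      simp
    · intro hγx
      have hd := hWd ⟨γ, hγ⟩ fun he => hγx (congrArg Subtype.val he)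
      rw [Set.disjoint_left] at hd ⊢
      rintro _ ⟨y, hy, rfl⟩ hy'
      obtain ⟨z, hz, rfl⟩ := hUN hy
      obtain ⟨w, hw, hwz⟩ := hUN hy'
      have : (⟨γ, hγ⟩ : Γ) • z = w := Subtype.ext hwz.symm
      exact hd ⟨z, hW₀W hz, this⟩ (hW₀W hw)

end ProperlyDiscontinuous

end TypeL
end

noncomputable section

namespace TypeL

open Matrix Function Filter Topology

/-! ### Normalized matrices -/

section MaxEntry

variable {ι : Type} [Fintype ι]

lemma continuous_maxEntry : Continuous (maxEntry : Matrix ι ι ℂ → ℝ) :=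
  continuous_norm (E := ι → ι → ℂ)

lemma maxEntry_smul (a : ℂ) (A : Matrix ι ι ℂ) : maxEntry (a • A) = ‖a‖ * maxEntry A :=
  norm_smul (β := ι → ι → ℂ) a A

lemma maxEntry_eq_zero {A : Matrix ι ι ℂ} : maxEntry A = 0 ↔ A = 0 :=
  norm_eq_zero (E := ι → ι → ℂ)

lemma isCompact_maxEntry_eq_one : IsCompact {A : Matrix ι ι ℂ | maxEntry A = 1} := by
  have := isCompact_sphere (0 : ι → ι → ℂ) 1
  convert! this using 1
  ext A
  exact mem_sphere_zero_iff_norm.symm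

/-- The multiple of a matrix with largest entry of absolute value `1`. -/
def normalized (A : Matrix ι ι ℂ) : Matrix ι ι ℂ := ((maxEntry A : ℂ)⁻¹) • A

lemma maxEntry_normalized {A : Matrix ι ι ℂ} (hA : A ≠ 0) : maxEntry (normalized A) = 1 := by
  have h0 : maxEntry A ≠ 0 := fun h => hA (maxEntry_eq_zero.1 h)
  have h1 : |maxEntry A| = maxEntry A := abs_of_nonneg (norm_nonneg (E := ι → ι → ℂ) A)
  rw [normalized, maxEntry_smul, norm_inv, Complex.norm_real, Real.norm_eq_abs, h1,
    inv_mul_cancel₀ h0]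

lemma ofReal_maxEntry_ne_zero {A : Matrix ι ι ℂ} (hA : A ≠ 0) : (maxEntry A : ℂ) ≠ 0 :=
  Complex.ofReal_ne_zero.2 fun h => hA (maxEntry_eq_zero.1 h)

lemma tendsto_normalized {A : ℕ → Matrix ι ι ℂ} {B : Matrix ι ι ℂ} (h : Tendsto A atTop (𝓝 B))
    (hB : B ≠ 0) : Tendsto (fun ν => normalized (A ν)) atTop (𝓝 (normalized B)) :=
  (((Complex.continuous_ofReal.comp continuous_maxEntry).tendsto B |>.comp h).inv₀
    (ofReal_maxEntry_ne_zero hB)).smul h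

lemma ofReal_maxEntry_inv_ne_zero {A : Matrix ι ι ℂ} (hA : A ≠ 0) : (maxEntry A : ℂ)⁻¹ ≠ 0 :=
  inv_ne_zero (ofReal_maxEntry_ne_zero hA)

instance {ι' : Type*} [Finite ι'] : FirstCountableTopology (Matrix ι' ι' ℂ) :=
  inferInstanceAs (FirstCountableTopology (ι' → ι' → ℂ))

end MaxEntry

/-! ### Matrices representing projective transformations -/

section Represents

variable {k m : ℕ} {A B : Matrix (Fin k) (Fin k) ℂ} {σ τ : PGLGroup k}

lemma exists_represents (σ : PGLGroup k) : ∃ A, Represents A σ := by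
  obtain ⟨g, rfl⟩ := ProjGenLinGroup.mk_surjective σ
  exact ⟨_, g, rfl, rfl⟩

lemma Represents.isUnit (h : Represents A σ) : IsUnit A := by
  obtain ⟨g, -, rfl⟩ := h
  exact g.isUnit

lemma Represents.exists_smul_eq (hA : Represents A σ) (hB : Represents B σ) :
    ∃ a : ℂ, a ≠ 0 ∧ B = a • A := by
  obtain ⟨g, rfl, rfl⟩ := hA
  obtain ⟨h, hh, rfl⟩ := hB
  obtain ⟨u, hu⟩ := ProjGenLinGroup.mk_eq_mk_iff.1 hh.symm
  refine ⟨u, u.ne_zero, ?_⟩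
  rw [← hu]
  ext i j
  simp [mul_comm]

lemma Represents.smul (hA : Represents A σ) {a : ℂ} (ha : a ≠ 0) : Represents (a • A) σ := by
  obtain ⟨g, rfl, rfl⟩ := hA
  refine ⟨g * GeneralLinearGroup.scalar (Fin k) (Units.mk0 a ha), by simp, ?_⟩
  ext i j
  simp [mul_comm]

lemma Represents.mul (hA : Represents A σ) (hB : Represents B τ) : Represents (A * B) (σ * τ) := by
  obtain ⟨g, rfl, rfl⟩ := hA
  obtain ⟨h, rfl, rfl⟩ := hB
  exact ⟨g * h, map_mul _ _ _, rfl⟩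

lemma Represents.inv (hA : Represents A σ) (hAB : A * B = 1) : Represents B σ⁻¹ := by
  obtain ⟨g, rfl, rfl⟩ := hA
  refine ⟨g⁻¹, map_inv _ _, ?_⟩
  rw [coe_units_inv]
  exact inv_eq_right_inv hAB

lemma Represents.smul_proj (hA : Represents A σ) (v : {v : Fin k → ℂ // v ≠ 0}) :
    ∃ h : A *ᵥ v.1 ≠ 0, σ • proj k v = proj k ⟨_, h⟩ := by
  obtain ⟨g, rfl, rfl⟩ := hA
  exact mk_smul_proj g v

lemma compound_mul_compound_eq_one (h : A * B = 1) : compound m A * compound m B = 1 := by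
  rw [← compound_mul, h, compound_one]

lemma isUnit_compound (hA : IsUnit A) : IsUnit (compound m A) := by
  obtain ⟨B, hB⟩ := hA.exists_right_inv
  exact IsUnit.of_mul_eq_one _ (compound_mul_compound_eq_one hB)

lemma RepresentsHat.exists_smul_eq {T : Matrix (MultiIndex m k) (MultiIndex m k) ℂ}
    (hT : RepresentsHat m T σ) (hA : Represents A σ) :
    ∃ c : ℂ, c ≠ 0 ∧ T = c • compound m A := by
  obtain ⟨B, hB, c, hc, rfl⟩ := hT
  obtain ⟨a, ha, rfl⟩ := hA.exists_smul_eq hB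
  exact ⟨c * a ^ m, mul_ne_zero hc (pow_ne_zero _ ha), by rw [compound_smul, smul_smul]⟩

lemma RepresentsHat.mul {T : Matrix (MultiIndex m k) (MultiIndex m k) ℂ}
    (hA : Represents A σ) (hT : RepresentsHat m T τ) :
    RepresentsHat m (compound m A * T) (σ * τ) := by
  obtain ⟨B, hB, c, hc, rfl⟩ := hT
  exact ⟨A * B, hA.mul hB, c, hc, by rw [compound_mul, mul_smul_comm]⟩

lemma RepresentsHat.smul {T : Matrix (MultiIndex m k) (MultiIndex m k) ℂ}
    (hT : RepresentsHat m T σ) {a : ℂ} (ha : a ≠ 0) : RepresentsHat m (a • T) σ := by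
  obtain ⟨B, hB, c, hc, rfl⟩ := hT
  exact ⟨B, hB, a * c, mul_ne_zero ha hc, by rw [smul_smul]⟩

lemma Represents.representsHat (hA : Represents A σ) : RepresentsHat m (compound m A) σ :=
  ⟨A, hA, 1, one_ne_zero, by rw [one_smul]⟩

end Represents

/-! ### Singular value decompositions of group elements -/

section SingularValues

variable {k : ℕ}

/-- `U * diag d * V` is a singular value decomposition of a matrix representing `σ`. -/
structure IsSVD (σ : PGLGroup k) (U V : Matrix (Fin k) (Fin k) ℂ) (d : Fin k → ℝ) : Prop where
  left_mem : U ∈ unitaryGroup (Fin k) ℂ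
  right_mem : V ∈ unitaryGroup (Fin k) ℂ
  antitone : Antitone d
  pos : ∀ i, 0 < d i
  represents : Represents (U * diagonal (fun i => (d i : ℂ)) * V) σ

lemma exists_isSVD (σ : PGLGroup k) : ∃ U V d, IsSVD σ U V d := by
  obtain ⟨A, hA⟩ := exists_represents σ
  obtain ⟨U, hU, V, hV, d, hd, hpos, rfl⟩ := exists_singular_decomposition A hA.isUnit
  exact ⟨U, V, d, hU, hV, hd, hpos, hA⟩

lemma conjTranspose_mul_self_of_mem {U : Matrix (Fin k) (Fin k) ℂ}
    (hU : U ∈ unitaryGroup (Fin k) ℂ) : Uᴴ * U = 1 :=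
  mem_unitaryGroup_iff'.1 hU

lemma mul_conjTranspose_self_of_mem {U : Matrix (Fin k) (Fin k) ℂ}
    (hU : U ∈ unitaryGroup (Fin k) ℂ) : U * Uᴴ = 1 :=
  mem_unitaryGroup_iff.1 hU

lemma submatrix_rev_mul_submatrix_rev (A B : Matrix (Fin k) (Fin k) ℂ) :
    A.submatrix id Fin.rev * B.submatrix Fin.rev id = A * B := by
  have := submatrix_mul_equiv A B id Fin.revPerm id
  rwa [submatrix_id_id] at this

lemma submatrix_rev_mul_diagonal_rev_mul (A B : Matrix (Fin k) (Fin k) ℂ) (d : Fin k → ℂ) :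
    A.submatrix id Fin.rev * diagonal (fun i => d i.rev) * B.submatrix Fin.rev id =
      A * diagonal d * B := by
  have h : A.submatrix id Fin.rev * diagonal (fun i => d i.rev) =
      (A * diagonal d).submatrix id Fin.rev := by
    ext i j
    simp [mul_diagonal]
  rw [h, submatrix_rev_mul_submatrix_rev]

/-- The inverse is V⁻¹D⁻¹U⁻¹, but D⁻¹ is increasing; reversing the coordinates restores the order.
The repelling plane of σ thus becomes the attracting plane of σ⁻¹. -/
lemma IsSVD.inv {σ : PGLGroup k} {U V : Matrix (Fin k) (Fin k) ℂ} {d : Fin k → ℝ}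
    (h : IsSVD σ U V d) :
    IsSVD σ⁻¹ (Vᴴ.submatrix id Fin.rev) (Uᴴ.submatrix Fin.rev id) (fun i => (d i.rev)⁻¹) where
  left_mem := by
    rw [mem_unitaryGroup_iff, star_eq_conjTranspose, conjTranspose_submatrix,
      submatrix_rev_mul_submatrix_rev, conjTranspose_conjTranspose,
      conjTranspose_mul_self_of_mem h.right_mem]
  right_mem := by
    rw [mem_unitaryGroup_iff', star_eq_conjTranspose, conjTranspose_submatrix,
      submatrix_rev_mul_submatrix_rev, conjTranspose_conjTranspose,
      mul_conjTranspose_self_of_mem h.left_mem]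
  antitone := fun i j hij =>
    inv_anti₀ (h.pos _) (h.antitone (Fin.rev_le_rev.2 hij))
  pos := fun i => inv_pos.2 (h.pos _)
  represents := by
    have hD : diagonal (fun i => (d i : ℂ)) * diagonal (fun i => ((d i)⁻¹ : ℂ)) = 1 := by
      rw [diagonal_mul_diagonal, ← diagonal_one]
      congr 1
      funext i
      exact mul_inv_cancel₀ (Complex.ofReal_ne_zero.2 (h.pos i).ne')
    refine h.represents.inv ?_
    have h2 := submatrix_rev_mul_diagonal_rev_mul Vᴴ Uᴴ fun i => ((d i)⁻¹ : ℂ)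
    simp only [Complex.ofReal_inv] at h2 ⊢
    rw [h2]
    calc U * diagonal (fun i => (d i : ℂ)) * V * (Vᴴ * diagonal (fun i => ((d i)⁻¹ : ℂ)) * Uᴴ)
        = U * (diagonal (fun i => (d i : ℂ)) * (V * Vᴴ) *
          diagonal (fun i => ((d i)⁻¹ : ℂ))) * Uᴴ := by simp only [Matrix.mul_assoc]
      _ = 1 := by
        rw [mul_conjTranspose_self_of_mem h.right_mem, Matrix.mul_one, hD, Matrix.mul_one,
          mul_conjTranspose_self_of_mem h.left_mem]

end SingularValues

/-! ### Normalized singular values on the exterior power -/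

section Weights

variable {n : ℕ}

/-- The first multiindex `0 < ... < n`. -/
def firstIndex (n : ℕ) : MultiIndex (n + 1) (2 * n + 2) :=
  Fin.castLEOrderEmb (by omega)

/-- The second multiindex `0 < ... < n - 1 < n + 1`. -/
def secondIndex (n : ℕ) : MultiIndex (n + 1) (2 * n + 2) :=
  OrderEmbedding.ofStrictMono
    (fun i => if i = Fin.last n then ⟨n + 1, by omega⟩ else ⟨i, by omega⟩) <| by
    intro i j hij
    have hi : i ≠ Fin.last n := (hij.trans_le (Fin.le_last j)).ne
    simp only [hi, if_false]
    split_ifs with hj <;> rw [Fin.lt_def] at hij ⊢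
    · simp only
      omega
    · exact hij

lemma val_firstIndex (i : Fin (n + 1)) : (firstIndex n i).val = i.val := rfl

lemma secondIndex_last : secondIndex n (Fin.last n) = ⟨n + 1, by omega⟩ :=
  if_pos rfl

lemma secondIndex_of_ne {i : Fin (n + 1)} (hi : i ≠ Fin.last n) :
    secondIndex n i = firstIndex n i :=
  if_neg hi

lemma firstIndex_ne_secondIndex : firstIndex n ≠ secondIndex n := by
  intro h
  have := congrArg Fin.val (DFunLike.congr_fun h (Fin.last n))
  rw [secondIndex_last, val_firstIndex, Fin.val_last] at this
  simp at this

lemma firstIndex_le (K : MultiIndex (n + 1) (2 * n + 2)) (i : Fin (n + 1)) :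
    firstIndex n i ≤ K i := by
  rw [Fin.le_def, val_firstIndex]
  induction i using Fin.induction with
  | zero => exact Nat.zero_le _
  | succ i ih =>
    have : K i.castSucc < K i.succ := K.strictMono i.castSucc_lt_succ
    rw [Fin.lt_def] at this
    simp only [Fin.val_castSucc, Fin.val_succ] at ih ⊢
    omega

lemma lt_last_of_ne_firstIndex {K : MultiIndex (n + 1) (2 * n + 2)} (hK : K ≠ firstIndex n) :
    n < (K (Fin.last n)).val := by
  by_contra! h
  obtain ⟨i, hi⟩ := exists_notMem_range_of_ne hK
  have hle : K i ≤ K (Fin.last n) := K.monotone (Fin.le_last i)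
  rw [Fin.le_def] at hle
  exact hi ⟨⟨(K i).val, by omega⟩, rfl⟩

lemma mem_range_firstIndex {a : Fin (2 * n + 2)} : a ∈ Set.range (firstIndex n) ↔ a.val ≤ n := by
  constructor
  · rintro ⟨i, rfl⟩
    rw [val_firstIndex]
    omega
  · intro h
    exact ⟨⟨a.val, by omega⟩, rfl⟩

/-- The ratio of a product of singular values to the product of the `n + 1` largest ones. -/
def weight (d : Fin (2 * n + 2) → ℝ) (K : MultiIndex (n + 1) (2 * n + 2)) : ℝ :=
  ∏ i, d (K i) / d (firstIndex n i)

variable {d : Fin (2 * n + 2) → ℝ}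

lemma weight_firstIndex (hd : ∀ i, 0 < d i) : weight d (firstIndex n) = 1 :=
  Finset.prod_eq_one fun _ _ => div_self (hd _).ne'

lemma weight_secondIndex (hd : ∀ i, 0 < d i) :
    weight d (secondIndex n) = d ⟨n + 1, by omega⟩ / d ⟨n, by omega⟩ := by
  rw [weight, Fin.prod_univ_castSucc, Finset.prod_eq_one, one_mul, secondIndex_last]
  · rfl
  · intro i _
    rw [secondIndex_of_ne (Fin.castSucc_lt_last i).ne, div_self (hd _).ne']

lemma weight_nonneg (hd : ∀ i, 0 < d i) (K : MultiIndex (n + 1) (2 * n + 2)) : 0 ≤ weight d K :=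
  Finset.prod_nonneg fun _ _ => (div_pos (hd _) (hd _)).le

lemma div_firstIndex_le_one (hd : ∀ i, 0 < d i) (ha : Antitone d)
    (K : MultiIndex (n + 1) (2 * n + 2)) (i : Fin (n + 1)) : d (K i) / d (firstIndex n i) ≤ 1 :=
  (div_le_one (hd _)).2 (ha (firstIndex_le K i))

lemma weight_le_one (hd : ∀ i, 0 < d i) (ha : Antitone d)
    (K : MultiIndex (n + 1) (2 * n + 2)) : weight d K ≤ 1 :=
  Finset.prod_le_one (fun _ _ => (div_pos (hd _) (hd _)).le)
    fun i _ => div_firstIndex_le_one hd ha K i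

/-- The first n factors are at most 1, and the last index of K exceeds n, so the last factor is at
most d_{n+1}/d_n. One limit being 0 therefore kills all weights but the first. -/
lemma weight_le_weight_secondIndex (hd : ∀ i, 0 < d i) (ha : Antitone d)
    {K : MultiIndex (n + 1) (2 * n + 2)} (hK : K ≠ firstIndex n) :
    weight d K ≤ weight d (secondIndex n) := by
  rw [weight_secondIndex hd, weight, Fin.prod_univ_castSucc]
  have h1 : ∏ i : Fin n, d (K i.castSucc) / d (firstIndex n i.castSucc) ≤ 1 :=
    Finset.prod_le_one (fun _ _ => (div_pos (hd _) (hd _)).le)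
      fun i _ => div_firstIndex_le_one hd ha K _
  refine (mul_le_of_le_one_left (div_pos (hd _) (hd _)).le h1).trans ?_
  change _ / d ⟨n, _⟩ ≤ _
  refine div_le_div_of_nonneg_right (ha ?_) (hd _).le
  rw [Fin.le_def]
  exact lt_last_of_ne_firstIndex hK

lemma compound_svd (hd : ∀ i, 0 < d i) (U V : Matrix (Fin (2 * n + 2)) (Fin (2 * n + 2)) ℂ) :
    compound (n + 1) (U * diagonal (fun i => (d i : ℂ)) * V) =
      ((∏ i, d (firstIndex n i) : ℝ) : ℂ) • (compound (n + 1) U *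
        diagonal (fun K => (weight d K : ℂ)) * compound (n + 1) V) := by
  rw [compound_mul, compound_mul, compound_diagonal, ← smul_mul_assoc, ← mul_smul_comm]
  congr 2
  rw [← diagonal_smul]
  congr 1
  funext K
  have h0 : (∏ i, d (firstIndex n i)) ≠ 0 := Finset.prod_ne_zero_iff.2 fun i _ => (hd _).ne'
  rw [Pi.smul_apply, smul_eq_mul, ← Complex.ofReal_mul, weight, Finset.prod_div_distrib,
    mul_div_cancel₀ _ h0, Complex.ofReal_prod]

end Weights

end TypeL
end

noncomputable section

namespace TypeL

open Matrix Function Filter Topology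

variable {n : ℕ} {Γ : Subgroup (PGLGroup (2 * n + 2))}

/-! ### Limits of normal sequences -/

section LimitStructure

lemma IsNormalSequence.ne_zero {σ : ℕ → PGLGroup (2 * n + 2)}
    {S : Matrix (MultiIndex (n + 1) (2 * n + 2)) (MultiIndex (n + 1) (2 * n + 2)) ℂ}
    (h : IsNormalSequence n Γ σ S) : S ≠ 0 := by
  obtain ⟨T, hT, hTS⟩ := h.2.2.2
  rintro rfl
  have h1 : Tendsto (fun ν => maxEntry (T ν)) atTop (𝓝 (maxEntry 0)) :=
    (continuous_maxEntry.tendsto _).comp hTS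
  simp only [fun ν => (hT ν).2, maxEntry_eq_zero.2] at h1
  exact one_ne_zero (tendsto_nhds_unique tendsto_const_nhds h1)

/-- Every sequence of distinct elements of `Γ` has a normal subsequence. -/
lemma exists_normal_subsequence {σ : ℕ → PGLGroup (2 * n + 2)} (hσ : ∀ ν, σ ν ∈ Γ)
    (hinj : Injective σ) : ∃ φ : ℕ → ℕ, StrictMono φ ∧ ∃ S, IsNormalSequence n Γ (σ ∘ φ) S := by
  choose A hA using fun ν => exists_represents (σ ν)
  have hA0 : ∀ ν, A ν ≠ 0 := fun ν => (hA ν).isUnit.ne_zero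
  have hC0 : ∀ ν, compound (n + 1) (A ν) ≠ 0 := fun ν =>
    have : Nonempty (MultiIndex (n + 1) (2 * n + 2)) := ⟨firstIndex n⟩
    (isUnit_compound (hA ν).isUnit).ne_zero
  obtain ⟨⟨B, S⟩, -, φ, hφ, hlim⟩ :=
    (isCompact_maxEntry_eq_one.prod isCompact_maxEntry_eq_one).tendsto_subseq
      (x := fun ν => (normalized (A ν), normalized (compound (n + 1) (A ν))))
      fun ν => ⟨maxEntry_normalized (hA0 ν), maxEntry_normalized (hC0 ν)⟩
  rw [nhds_prod_eq] at hlim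
  refine ⟨φ, hφ, S, fun ν => hσ _, hinj.comp hφ.injective, ⟨_, B, fun ν => ⟨?_, ?_⟩, hlim.fst⟩,
    ⟨_, fun ν => ⟨?_, ?_⟩, hlim.snd⟩⟩
  · exact (hA _).smul (ofReal_maxEntry_inv_ne_zero (hA0 _))
  · exact maxEntry_normalized (hA0 _)
  · exact (hA _).representsHat.smul (ofReal_maxEntry_inv_ne_zero (hC0 _))
  · exact maxEntry_normalized (hC0 _)

/-- The limit of the induced transformations, in terms of the limits of the singular value
decompositions. -/
lemma IsNormalSequence.exists_limit_svd {σ : ℕ → PGLGroup (2 * n + 2)}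
    {S : Matrix (MultiIndex (n + 1) (2 * n + 2)) (MultiIndex (n + 1) (2 * n + 2)) ℂ}
    (h : IsNormalSequence n Γ σ S) {U V : ℕ → Matrix (Fin (2 * n + 2)) (Fin (2 * n + 2)) ℂ}
    {d : ℕ → Fin (2 * n + 2) → ℝ} (hsvd : ∀ ν, IsSVD (σ ν) (U ν) (V ν) (d ν)) :
    ∃ φ : ℕ → ℕ, StrictMono φ ∧ ∃ U₀ ∈ unitaryGroup (Fin (2 * n + 2)) ℂ,
      ∃ V₀ ∈ unitaryGroup (Fin (2 * n + 2)) ℂ, ∃ (e : MultiIndex (n + 1) (2 * n + 2) → ℝ) (c : ℂ),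
        c ≠ 0 ∧ Tendsto (U ∘ φ) atTop (𝓝 U₀) ∧ Tendsto (V ∘ φ) atTop (𝓝 V₀) ∧
        Tendsto (fun ν => weight (d (φ ν))) atTop (𝓝 e) ∧
        S = c • (compound (n + 1) U₀ * diagonal (fun K => (e K : ℂ)) * compound (n + 1) V₀) := by
  have hS := h.ne_zero
  obtain ⟨-, -, -, T, hT, hTS⟩ := h
  obtain ⟨⟨U₀, V₀, e⟩, ⟨hU₀, hV₀, -⟩, φ, hφ, hlim⟩ :=
    (isCompact_unitaryGroup.prod (isCompact_unitaryGroup.prod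
      (isCompact_univ_pi fun _ : MultiIndex (n + 1) (2 * n + 2) =>
        isCompact_Icc (a := (0 : ℝ)) (b := 1)))).tendsto_subseq
      (x := fun ν => (U ν, V ν, weight (d ν)))
      fun ν => ⟨(hsvd ν).left_mem, (hsvd ν).right_mem, fun K _ =>
        ⟨weight_nonneg (hsvd ν).pos K, weight_le_one (hsvd ν).pos (hsvd ν).antitone K⟩⟩
  rw [nhds_prod_eq, nhds_prod_eq] at hlim
  have hUlim : Tendsto (fun ν => U (φ ν)) atTop (𝓝 U₀) := hlim.fst
  have hVlim : Tendsto (fun ν => V (φ ν)) atTop (𝓝 V₀) := hlim.snd.fst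
  have helim : Tendsto (fun ν => weight (d (φ ν))) atTop (𝓝 e) := hlim.snd.snd
  have hTφ := hTS.comp hφ.tendsto_atTop
  set W : ℕ → Matrix (MultiIndex (n + 1) (2 * n + 2)) (MultiIndex (n + 1) (2 * n + 2)) ℂ :=
    fun ν => compound (n + 1) (U ν) * diagonal (fun K => (weight (d ν) K : ℂ)) *
      compound (n + 1) (V ν) with hW
  have hWlim : Tendsto (fun ν => W (φ ν)) atTop (𝓝 (compound (n + 1) U₀ *
      diagonal (fun K => (e K : ℂ)) * compound (n + 1) V₀)) := by
    have hdiag : Continuous fun w : MultiIndex (n + 1) (2 * n + 2) → ℝ =>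
        diagonal fun K => (w K : ℂ) := by
      refine Continuous.matrix_diagonal (continuous_pi fun K => ?_)
      exact Complex.continuous_ofReal.comp (continuous_apply K)
    exact (((continuous_compound.tendsto _).comp hUlim).mul
      ((hdiag.tendsto _).comp helim)).mul ((continuous_compound.tendsto _).comp hVlim)
  have hc : ∀ ν, ∃ c : ℂ, T ν = c • W ν := by
    intro ν
    obtain ⟨c, -, hc⟩ := (hT ν).1.exists_smul_eq (hsvd ν).represents
    exact ⟨_, by rw [hc, compound_svd (hsvd ν).pos, smul_smul]⟩
  choose c hc using hc
  -- The first weight is 1, so the scalar can be read off as a matrix entry once the unitary factors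
  -- are undone; this makes the scalars converge.
  have hcval : ∀ ν, c ν = (compound (n + 1) (U ν)ᴴ * T ν * compound (n + 1) (V ν)ᴴ)
      (firstIndex n) (firstIndex n) := by
    intro ν
    have h1 := compound_mul_compound_eq_one (m := n + 1)
      (conjTranspose_mul_self_of_mem (hsvd ν).left_mem)
    have h2 := compound_mul_compound_eq_one (m := n + 1)
      (mul_conjTranspose_self_of_mem (hsvd ν).right_mem)
    have h3 : compound (n + 1) (U ν)ᴴ * T ν * compound (n + 1) (V ν)ᴴ =
        c ν • diagonal (fun K => (weight (d ν) K : ℂ)) := by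
      rw [hc ν, mul_smul_comm, smul_mul_assoc]
      congr 1
      calc _ = (compound (n + 1) (U ν)ᴴ * compound (n + 1) (U ν)) *
            diagonal (fun K => (weight (d ν) K : ℂ)) *
            (compound (n + 1) (V ν) * compound (n + 1) (V ν)ᴴ) := by
              simp only [hW, Matrix.mul_assoc]
        _ = _ := by rw [h1, h2, Matrix.one_mul, Matrix.mul_one]
    rw [h3, Matrix.smul_apply, diagonal_apply_eq, weight_firstIndex (hsvd ν).pos]
    simp
  obtain ⟨c₀, hc₀⟩ : ∃ c₀, Tendsto (fun ν => c (φ ν)) atTop (𝓝 c₀) := by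
    simp only [hcval]
    have hcont := (continuous_compound (m := n + 1) (k := 2 * n + 2)).comp
      continuous_id.matrix_conjTranspose
    have hmat := (((hcont.tendsto _).comp hUlim).mul hTφ).mul ((hcont.tendsto _).comp hVlim)
    exact ⟨_, ((continuous_id.matrix_elem (firstIndex n) (firstIndex n)).tendsto _).comp hmat⟩
  have hfin : S = c₀ • (compound (n + 1) U₀ * diagonal (fun K => (e K : ℂ)) *
      compound (n + 1) V₀) := by
    refine tendsto_nhds_unique hTφ ?_
    have : T ∘ φ = fun ν => c (φ ν) • W (φ ν) := funext fun ν => hc _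
    rw [this]
    exact hc₀.smul hWlim
  refine ⟨φ, hφ, U₀, hU₀, V₀, hV₀, e, c₀, ?_, hUlim, hVlim, helim, hfin⟩
  rintro rfl
  exact hS (by rw [hfin, zero_smul])

end LimitStructure

/-! ### Limit planes and the rank-one property -/

section LimitPlanes

variable {U V : Matrix (Fin (2 * n + 2)) (Fin (2 * n + 2)) ℂ}
  {S : Matrix (MultiIndex (n + 1) (2 * n + 2)) (MultiIndex (n + 1) (2 * n + 2)) ℂ}
  {e : MultiIndex (n + 1) (2 * n + 2) → ℝ} {c : ℂ}

lemma linearIndependent_of_plucker_ne_zero {m k : ℕ} {x : Fin m → Fin k → ℂ}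
    (h : plucker x ≠ 0) : LinearIndependent ℂ x := by
  obtain ⟨K, hK⟩ := Function.ne_iff.1 h
  set M : Matrix (Fin m) (Fin m) ℂ := of fun i j => x j (K i)
  have hM : M.det ≠ 0 := hK
  rw [Fintype.linearIndependent_iff]
  intro g hg
  have : M *ᵥ g = 0 := by
    funext i
    have := congrFun hg (K i)
    simp only [Finset.sum_apply, Pi.smul_apply, smul_eq_mul] at this
    simp only [mulVec, dotProduct, M, of_apply]
    exact (Finset.sum_congr rfl fun j _ => mul_comm _ _).trans this
  exact congrFun (eq_zero_of_mulVec_eq_zero hM this)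

/-- A basis of the `n`-plane spanned by the first `n` coordinate vectors and a combination of
the following two. -/
def pencilBasis (n : ℕ) (α β : ℂ) : Fin (n + 1) → Fin (2 * n + 2) → ℂ :=
  update (fun j => Pi.single (firstIndex n j) 1) (Fin.last n)
    (α • Pi.single ⟨n, by omega⟩ 1 + β • Pi.single ⟨n + 1, by omega⟩ 1)

lemma plucker_update_add {m k : ℕ} (x : Fin m → Fin k → ℂ) (i : Fin m) (α β : ℂ)
    (a b : Fin k → ℂ) : plucker (update x i (α • a + β • b)) =
      α • plucker (update x i a) + β • plucker (update x i b) := by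
  have hcol : ∀ (z : Fin k → ℂ) (K : MultiIndex m k), plucker (update x i z) K =
      ((of fun r j => x j (K r) : Matrix (Fin m) (Fin m) ℂ).updateCol i fun r => z (K r)).det := by
    intro z K
    rw [plucker]
    congr 1
    ext r j
    rcases eq_or_ne j i with rfl | hj <;> simp [*]
  funext K
  rw [Pi.add_apply, Pi.smul_apply, Pi.smul_apply, hcol, hcol, hcol, smul_eq_mul, smul_eq_mul,
    ← det_updateCol_smul, ← det_updateCol_smul, ← det_updateCol_add]
  rfl

lemma plucker_pencilBasis (α β : ℂ) : plucker (pencilBasis n α β) =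
    α • Pi.single (firstIndex n) 1 + β • Pi.single (secondIndex n) 1 := by
  rw [pencilBasis, plucker_update_add, ← plucker_single, ← plucker_single]
  congr 3
  · exact update_eq_self _ _
  · funext j
    rcases eq_or_ne j (Fin.last n) with rfl | hj
    · rw [update_self, secondIndex_last]
    · rw [update_of_ne hj, secondIndex_of_ne hj]

/-- A plane of the pencil is a limit plane, if the limit of the induced transformations does not
degenerate on it. -/
lemma IsNormalSequence.isLimitPlane_pencil {σ : ℕ → PGLGroup (2 * n + 2)}
    (h : IsNormalSequence n Γ σ S) (hU : U ∈ unitaryGroup (Fin (2 * n + 2)) ℂ)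
    (hV : V ∈ unitaryGroup (Fin (2 * n + 2)) ℂ) (hc : c ≠ 0)
    (hS : S = c • (compound (n + 1) U * diagonal (fun K => (e K : ℂ)) * compound (n + 1) V))
    (he : e (firstIndex n) = 1) {α β : ℂ} (hαβ : α ≠ 0 ∨ β ≠ 0)
    (hβ : e (secondIndex n) ≠ 0 ∨ β = 0) :
    IsLimitPlane n Γ
      (Submodule.span ℂ (Set.range fun j => U *ᵥ pencilBasis n α β j)) := by
  have hplucker : plucker (fun j => U *ᵥ pencilBasis n α β j) = compound (n + 1) U *ᵥ
      (α • Pi.single (firstIndex n) 1 + β • Pi.single (secondIndex n) 1) := by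
    rw [plucker_mulVec, plucker_pencilBasis]
  have hw : α • Pi.single (firstIndex n) (1 : ℂ) + β • Pi.single (secondIndex n) 1 ≠ 0 := by
    intro h0
    have h1 := congrFun h0 (firstIndex n)
    have h2 := congrFun h0 (secondIndex n)
    simp [firstIndex_ne_secondIndex, firstIndex_ne_secondIndex.symm] at h1 h2
    tauto
  have hUU := compound_mul_compound_eq_one (m := n + 1) (conjTranspose_mul_self_of_mem hU)
  have hVV := compound_mul_compound_eq_one (m := n + 1) (mul_conjTranspose_self_of_mem hV)
  refine ⟨_, σ, S, linearIndependent_of_plucker_ne_zero ?_, rfl, h, ?_⟩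
  · rw [hplucker]
    intro h0
    have := congrArg (compound (n + 1) Uᴴ *ᵥ ·) h0
    simp only [mulVec_mulVec, hUU, one_mulVec, mulVec_zero] at this
    exact hw this
  -- A preimage under S, found by inverting each factor. If the second weight vanishes then β = 0,
  -- and the quotient β / 0 is 0 as needed.
  · refine ⟨c⁻¹ • (compound (n + 1) Vᴴ *ᵥ (α • Pi.single (firstIndex n) 1 +
      (β / e (secondIndex n)) • Pi.single (secondIndex n) 1)), ?_⟩
    rw [mulVecLin_apply, hplucker, hS, mulVec_smul, smul_mulVec, smul_smul, inv_mul_cancel₀ hc,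
      one_smul, mulVec_mulVec, Matrix.mul_assoc, hVV, Matrix.mul_one, ← mulVec_mulVec]
    congr 1
    rw [mulVec_add, mulVec_smul, mulVec_smul, diagonal_mulVec_single, diagonal_mulVec_single, he]
    rcases hβ with hβ | rfl
    · have : (e (secondIndex n) : ℂ) ≠ 0 := Complex.ofReal_ne_zero.2 hβ
      congr 1
      · simp
      · rw [← Pi.single_smul, ← Pi.single_smul]
        congr 1
        simp only [mul_one, smul_eq_mul]
        field_simp
    · simp

/-- The pencil sweeps out U⟨e_0, …, e_{n+1}⟩. The parameter t may be 0, which covers vectors on the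
axis common to all its planes. -/
lemma mem_span_pencil (hU : U ∈ unitaryGroup (Fin (2 * n + 2)) ℂ) {v : Fin (2 * n + 2) → ℂ}
    {α β t : ℂ} (hv : ∀ a : Fin (2 * n + 2), n + 1 < a.val → (Uᴴ *ᵥ v) a = 0)
    (hα : (Uᴴ *ᵥ v) ⟨n, by omega⟩ = t * α) (hβ : (Uᴴ *ᵥ v) ⟨n + 1, by omega⟩ = t * β) :
    v ∈ Submodule.span ℂ (Set.range fun j => U *ᵥ pencilBasis n α β j) := by
  set u := Uᴴ *ᵥ v with hu
  have hUu : U *ᵥ u = v := by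
    rw [hu, mulVec_mulVec, mul_conjTranspose_self_of_mem hU, one_mulVec]
  have hsum : u = ∑ j, (update (fun j => u (firstIndex n j)) (Fin.last n) t) j •
      pencilBasis n α β j := by
    rw [Fin.sum_univ_castSucc, update_self, pencilBasis, update_self]
    have h1 : ∀ j : Fin n, (update (fun j => u (firstIndex n j)) (Fin.last n) t) j.castSucc •
        (update (fun j => Pi.single (firstIndex n j) 1) (Fin.last n)
          (α • Pi.single ⟨n, by omega⟩ 1 + β • Pi.single ⟨n + 1, by omega⟩ 1) :
            Fin (n + 1) → Fin (2 * n + 2) → ℂ) j.castSucc =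
        (Pi.single (firstIndex n j.castSucc) (u (firstIndex n j.castSucc)) :
          Fin (2 * n + 2) → ℂ) := by
      intro j
      rw [update_of_ne (Fin.castSucc_lt_last j).ne, update_of_ne (Fin.castSucc_lt_last j).ne,
        ← Pi.single_smul, smul_eq_mul, mul_one]
    rw [Finset.sum_congr rfl fun j _ => h1 j]
    funext a
    rw [Pi.add_apply, Finset.sum_apply]
    rcases lt_or_ge a.val n with ha | ha
    · rw [Finset.sum_eq_single ⟨a.val, ha⟩]
      · have h2 : firstIndex n (Fin.castSucc ⟨a.val, ha⟩) = a := rfl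
        have h3 : a ≠ ⟨n, by omega⟩ := fun h => by simp [h] at ha
        have h4 : a ≠ ⟨n + 1, by omega⟩ := fun h => by simp [h] at ha
        rw [h2]
        simp [h3, h4]
      · intro j _ hj
        refine Pi.single_eq_of_ne (fun h => hj ?_) _
        rw [Fin.ext_iff]
        exact (congrArg Fin.val h).symm
      · simp
    · rw [Finset.sum_eq_zero, zero_add]
      · rcases eq_or_ne a ⟨n, by omega⟩ with h3 | h3
        · rw [h3, hα]
          simp
        rcases eq_or_ne a ⟨n + 1, by omega⟩ with h4 | h4
        · rw [h4, hβ]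
          simp
        · simp only [Pi.smul_apply, Pi.add_apply, Pi.single_eq_of_ne h3, Pi.single_eq_of_ne h4]
          rw [hv a]
          · simp
          · rw [Ne, Fin.ext_iff] at h3 h4
            simp only at h3 h4
            omega
      · intro j _
        refine Pi.single_eq_of_ne (fun h => ?_) _
        rw [h] at ha
        exact absurd j.2 (not_lt.2 ha)
  rw [← hUu, hsum, mulVec_sum]
  refine Submodule.sum_mem _ fun j _ => ?_
  rw [mulVec_smul]
  exact Submodule.smul_mem _ _ (Submodule.subset_span ⟨j, rfl⟩)

/-- If the complement of the limit set contains an `n`-plane, then the limit of the induced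
transformations has rank one. -/
lemma IsNormalSequence.weight_limit_secondIndex_eq_zero
    (hL : ∃ L : Submodule ℂ (Fin (2 * n + 2) → ℂ),
      Module.finrank ℂ L = n + 1 ∧ points L ⊆ omegaSet n Γ) {σ : ℕ → PGLGroup (2 * n + 2)}
    (h : IsNormalSequence n Γ σ S) (hU : U ∈ unitaryGroup (Fin (2 * n + 2)) ℂ)
    (hV : V ∈ unitaryGroup (Fin (2 * n + 2)) ℂ) (hc : c ≠ 0)
    (hS : S = c • (compound (n + 1) U * diagonal (fun K => (e K : ℂ)) * compound (n + 1) V))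
    (he : e (firstIndex n) = 1) : e (secondIndex n) = 0 := by
  by_contra hne
  obtain ⟨L, hdim, hLΩ⟩ := hL
  -- The last n coordinates of Uᴴv impose n conditions on the (n+1)-dimensional L, so L contains a
  -- nonzero vector of U⟨e_0, …, e_{n+1}⟩.
  let f : L →ₗ[ℂ] (Fin n → ℂ) :=
    { toFun := fun v a => (Uᴴ *ᵥ v.1) ⟨n + 2 + a, by omega⟩
      map_add' := fun v w => by
        funext a
        simp [mulVec_add]
      map_smul' := fun t v => by
        funext a
        simp [mulVec_smul] }
  obtain ⟨⟨v, hvL⟩, hvker, hv0⟩ := (Submodule.ne_bot_iff _).1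
    (LinearMap.ker_ne_bot_of_finrank_lt (f := f) (by simp [hdim]))
  have hv0 : v ≠ 0 := fun h => hv0 (Subtype.ext h)
  have hv : ∀ a : Fin (2 * n + 2), n + 1 < a.val → (Uᴴ *ᵥ v) a = 0 := by
    intro a ha
    have := congrFun (LinearMap.mem_ker.1 hvker) ⟨a.val - (n + 2), by omega⟩
    have heq : (⟨n + 2 + (a.val - (n + 2)), by omega⟩ : Fin (2 * n + 2)) = a := by
      rw [Fin.ext_iff]
      simp only
      omega
    simp only [f, LinearMap.coe_mk, AddHom.coe_mk, heq, Pi.zero_apply] at this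
    exact this
  set α := (Uᴴ *ᵥ v) ⟨n, by omega⟩ with hα
  set β := (Uᴴ *ᵥ v) ⟨n + 1, by omega⟩ with hβ
  have hmem : proj (2 * n + 2) ⟨v, hv0⟩ ∈ limitSet n Γ := by
    by_cases h0 : α ≠ 0 ∨ β ≠ 0
    · exact ⟨_, h.isLimitPlane_pencil hU hV hc hS he h0 (Or.inl hne), proj_mem_points.2
        (mem_span_pencil (t := 1) hU hv (by rw [one_mul]) (by rw [one_mul]))⟩
    -- Here v lies on the axis of the pencil, so any plane of it will do.
    · push Not at h0
      exact ⟨_, h.isLimitPlane_pencil hU hV hc hS he (α := 1) (β := 0) (Or.inl one_ne_zero)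
        (Or.inr rfl), proj_mem_points.2 (mem_span_pencil (t := 0) hU hv
          (by rw [← hα, h0.1, zero_mul]) (by rw [← hβ, h0.2, zero_mul]))⟩
  exact hLΩ (proj_mem_points.2 hvL) hmem

/-- When the limit of the induced transformations has rank one, its image is a single `n`-plane. -/
lemma apply_eq_zero_of_mem_range (hU : U ∈ unitaryGroup (Fin (2 * n + 2)) ℂ)
    (hS : S = c • (compound (n + 1) U * diagonal (fun K => (e K : ℂ)) * compound (n + 1) V))
    (he : ∀ K, K ≠ firstIndex n → e K = 0) {x : Fin (n + 1) → Fin (2 * n + 2) → ℂ}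
    (hx : LinearIndependent ℂ x) (hxS : plucker x ∈ LinearMap.range S.mulVecLin)
    {v : Fin (2 * n + 2) → ℂ} (hv : v ∈ Submodule.span ℂ (Set.range x)) {a : Fin (2 * n + 2)}
    (ha : n < a.val) : (Uᴴ *ᵥ v) a = 0 := by
  have hUU := compound_mul_compound_eq_one (m := n + 1) (conjTranspose_mul_self_of_mem hU)
  obtain ⟨w, hw⟩ := hxS
  have hinj : Function.Injective (Uᴴ *ᵥ · : (Fin (2 * n + 2) → ℂ) → _) :=
    mulVec_injective_of_isUnit (IsUnit.of_mul_eq_one _ (conjTranspose_mul_self_of_mem hU))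
  have hy : LinearIndependent ℂ fun j => Uᴴ *ᵥ x j :=
    hx.map' Uᴴ.mulVecLin (LinearMap.ker_eq_bot.2 hinj)
  obtain ⟨s, hs⟩ : ∃ s : ℂ, plucker (fun j => Uᴴ *ᵥ x j) = s • Pi.single (firstIndex n) 1 := by
    refine ⟨c * e (firstIndex n) * (compound (n + 1) V *ᵥ w) (firstIndex n), ?_⟩
    rw [plucker_mulVec, ← hw, mulVecLin_apply, hS, smul_mulVec, mulVec_smul, mulVec_mulVec,
      ← Matrix.mul_assoc, ← Matrix.mul_assoc, hUU, Matrix.one_mul, ← mulVec_mulVec]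
    funext K
    rw [Pi.smul_apply, mulVec_diagonal, Pi.smul_apply]
    rcases eq_or_ne K (firstIndex n) with rfl | hK
    · simp [mul_assoc]
    · simp [he K hK, hK]
  have hle : Submodule.span ℂ (Set.range x) ≤
      LinearMap.ker ((LinearMap.proj a).comp Uᴴ.mulVecLin) := by
    rw [Submodule.span_le]
    rintro _ ⟨j, rfl⟩
    exact apply_eq_zero_of_plucker_eq_single hy hs
      (fun h => absurd (mem_range_firstIndex.1 h) (not_le.2 ha)) j
  exact hle hv

end LimitPlanes

end TypeL
end

noncomputable section

namespace TypeL

open Matrix Function Filter Topology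

/-! ### Accumulation points of the left unitary factors -/

section ClusterSet

variable {k : ℕ} {Γ : Subgroup (PGLGroup k)}

/-- The accumulation points of the left unitary factors of the elements of `Γ`. -/
def clusterSet (Γ : Subgroup (PGLGroup k)) : Set (Matrix (Fin k) (Fin k) ℂ) :=
  {U | U ∈ unitaryGroup (Fin k) ℂ ∧
    ∀ O ∈ 𝓝 U, {σ | σ ∈ Γ ∧ ∃ U' ∈ O, ∃ V d, IsSVD σ U' V d}.Infinite}

lemma mem_clusterSet_of_tendsto {σ : ℕ → PGLGroup k} (hσ : ∀ ν, σ ν ∈ Γ) (hinj : Injective σ)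
    {U V : ℕ → Matrix (Fin k) (Fin k) ℂ} {d : ℕ → Fin k → ℝ}
    (hsvd : ∀ ν, IsSVD (σ ν) (U ν) (V ν) (d ν)) {U₀ : Matrix (Fin k) (Fin k) ℂ}
    (hU₀ : U₀ ∈ unitaryGroup (Fin k) ℂ) (hlim : Tendsto U atTop (𝓝 U₀)) :
    U₀ ∈ clusterSet Γ := by
  refine ⟨hU₀, fun O hO => ?_⟩
  obtain ⟨N, hN⟩ := eventually_atTop.1 (hlim.eventually_mem hO)
  refine ((Set.Ici_infinite N).image hinj.injOn).mono ?_
  rintro _ ⟨ν, hν, rfl⟩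
  exact ⟨hσ ν, _, hN ν hν, _, _, hsvd ν⟩

lemma exists_seq_of_mem_clusterSet {U₀ : Matrix (Fin k) (Fin k) ℂ} (h : U₀ ∈ clusterSet Γ) :
    ∃ (σ : ℕ → PGLGroup k) (U V : ℕ → Matrix (Fin k) (Fin k) ℂ) (d : ℕ → Fin k → ℝ),
      (∀ ν, σ ν ∈ Γ) ∧ Injective σ ∧ (∀ ν, IsSVD (σ ν) (U ν) (V ν) (d ν)) ∧
      Tendsto U atTop (𝓝 U₀) := by
  classical
  obtain ⟨O, hO⟩ := (𝓝 U₀).exists_antitone_basis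
  -- Recursive choice of pairs (neighbourhood index, group element): increasing indices force
  -- convergence, new elements force injectivity.
  obtain ⟨f, hf, hfr⟩ := exists_seq_of_forall_finset_exists
    (fun x : ℕ × PGLGroup k => x.2 ∈ Γ ∧ ∃ U' ∈ O x.1, ∃ V d, IsSVD x.2 U' V d)
    (fun x y => x.1 < y.1 ∧ x.2 ≠ y.2) (by
      intro s _
      obtain ⟨σ, hσ, hσs⟩ := (h.2 (O (s.sup Prod.fst + 1))
        (hO.1.mem_of_mem trivial)).exists_notMem_finset (s.image Prod.snd)
      refine ⟨(s.sup Prod.fst + 1, σ), hσ, fun x hx => ⟨?_, ?_⟩⟩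
      · exact Nat.lt_succ_of_le (Finset.le_sup (f := Prod.fst) hx)
      · rintro rfl
        exact hσs (Finset.mem_image_of_mem _ hx))
  choose hΓ U hU V d hsvd using hf
  have hmono : StrictMono fun ν => (f ν).1 := fun a b hab => (hfr a b hab).1
  refine ⟨fun ν => (f ν).2, U, V, d, hΓ, ?_, hsvd, ?_⟩
  · intro a b hab
    by_contra hne
    rcases lt_or_gt_of_ne hne with h1 | h1
    · exact (hfr a b h1).2 hab
    · exact (hfr b a h1).2 hab.symm
  · exact hO.1.tendsto_right_iff.2 fun i _ => eventually_atTop.2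
      ⟨i, fun ν hν => hO.2 (hν.trans hmono.le_apply) (hU ν)⟩

lemma isClosed_clusterSet : IsClosed (clusterSet Γ) := by
  refine isClosed_of_closure_subset fun U hU => ⟨?_, fun O hO => ?_⟩
  · exact closure_minimal (fun _ h => h.1) isCompact_unitaryGroup.isClosed hU
  · obtain ⟨W, hWO, hW, hUW⟩ := mem_nhds_iff.1 hO
    obtain ⟨U', hU'W, hU'⟩ := mem_closure_iff.1 hU W hW hUW
    exact hU'.2 O (mem_of_superset (hW.mem_nhds hU'W) hWO)

lemma isCompact_clusterSet : IsCompact (clusterSet Γ) :=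
  isCompact_unitaryGroup.of_isClosed_subset isClosed_clusterSet fun _ h => h.1

end ClusterSet

/-! ### Closedness of the limit set and proper discontinuity -/

variable {n : ℕ} {Γ : Subgroup (PGLGroup (2 * n + 2))}

/-- If the complement of the limit set contains an `n`-plane, then the singular value
decompositions of a normal sequence have a subsequence which converges to a transformation of
rank one. -/
lemma IsNormalSequence.exists_rank_one_limit_svd
    (hL : ∃ L : Submodule ℂ (Fin (2 * n + 2) → ℂ),
      Module.finrank ℂ L = n + 1 ∧ points L ⊆ omegaSet n Γ) {σ : ℕ → PGLGroup (2 * n + 2)}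
    {S : Matrix (MultiIndex (n + 1) (2 * n + 2)) (MultiIndex (n + 1) (2 * n + 2)) ℂ}
    (h : IsNormalSequence n Γ σ S) {U V : ℕ → Matrix (Fin (2 * n + 2)) (Fin (2 * n + 2)) ℂ}
    {d : ℕ → Fin (2 * n + 2) → ℝ} (hsvd : ∀ ν, IsSVD (σ ν) (U ν) (V ν) (d ν)) :
    ∃ φ : ℕ → ℕ, StrictMono φ ∧ ∃ U₀ ∈ unitaryGroup (Fin (2 * n + 2)) ℂ,
      ∃ V₀ ∈ unitaryGroup (Fin (2 * n + 2)) ℂ, ∃ (e : MultiIndex (n + 1) (2 * n + 2) → ℝ) (c : ℂ),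
        c ≠ 0 ∧ Tendsto (U ∘ φ) atTop (𝓝 U₀) ∧ Tendsto (V ∘ φ) atTop (𝓝 V₀) ∧
        Tendsto (fun ν => weight (d (φ ν)) (secondIndex n)) atTop (𝓝 0) ∧
        S = c • (compound (n + 1) U₀ * diagonal (fun K => (e K : ℂ)) * compound (n + 1) V₀) ∧
        e (firstIndex n) = 1 ∧ ∀ K, K ≠ firstIndex n → e K = 0 := by
  obtain ⟨φ, hφ, U₀, hU₀, V₀, hV₀, e, c, hc, hU, hV, he, hS⟩ := h.exists_limit_svd hsvd
  have heK : ∀ K, Tendsto (fun ν => weight (d (φ ν)) K) atTop (𝓝 (e K)) :=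
    fun K => tendsto_pi_nhds.1 he K
  have he1 : e (firstIndex n) = 1 := by
    refine tendsto_nhds_unique (heK _) ?_
    simp only [weight_firstIndex (hsvd _).pos]
    exact tendsto_const_nhds
  have he2 := h.weight_limit_secondIndex_eq_zero hL hU₀ hV₀ hc hS he1
  refine ⟨φ, hφ, U₀, hU₀, V₀, hV₀, e, c, hc, hU, hV, he2 ▸ heK _, hS, he1, fun K hK => ?_⟩
  refine le_antisymm ?_ ?_
  · rw [← he2]
    exact le_of_tendsto_of_tendsto' (heK _) (heK _) fun ν =>
      weight_le_weight_secondIndex (hsvd _).pos (hsvd _).antitone hK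
  · exact ge_of_tendsto' (heK _) fun ν => weight_nonneg (hsvd _).pos K

/-- The limit set is swept out by the `n`-planes attached to the accumulation points of the left
unitary factors. -/
lemma proj_mem_limitSet_iff
    (hL : ∃ L : Submodule ℂ (Fin (2 * n + 2) → ℂ),
      Module.finrank ℂ L = n + 1 ∧ points L ⊆ omegaSet n Γ)
    (v : {v : Fin (2 * n + 2) → ℂ // v ≠ 0}) :
    proj (2 * n + 2) v ∈ limitSet n Γ ↔
      ∃ U ∈ clusterSet Γ, ∀ a : Fin (2 * n + 2), n < a.val → (Uᴴ *ᵥ v.1) a = 0 := by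
  constructor
  · rintro ⟨L, ⟨x, σ, S, hx, rfl, h, hxS⟩, hv⟩
    choose U V d hsvd using fun ν => exists_isSVD (σ ν)
    obtain ⟨φ, hφ, U₀, hU₀, V₀, hV₀, e, c, hc, hU, -, -, hS, -, he⟩ :=
      h.exists_rank_one_limit_svd hL hsvd
    refine ⟨U₀, mem_clusterSet_of_tendsto (fun ν => h.1 (φ ν)) (h.2.1.comp hφ.injective)
      (fun ν => hsvd (φ ν)) hU₀ hU, fun a ha => ?_⟩
    exact apply_eq_zero_of_mem_range hU₀ hS he hx hxS (proj_mem_points.1 hv) ha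
  · rintro ⟨U₀, hU₀, hv⟩
    obtain ⟨σ, U, V, d, hσ, hinj, hsvd, hU⟩ := exists_seq_of_mem_clusterSet hU₀
    obtain ⟨ψ, hψ, S, h⟩ := exists_normal_subsequence hσ hinj
    obtain ⟨φ, hφ, U₁, hU₁, V₁, hV₁, e, c, hc, hU', -, -, hS, he, -⟩ :=
      h.exists_rank_one_limit_svd hL fun ν => hsvd (ψ ν)
    -- The decompositions are those that define the accumulation point, so passing to a normal
    -- subsequence does not change the limit.
    have hUeq : U₁ = U₀ :=
      tendsto_nhds_unique hU' (hU.comp (hψ.tendsto_atTop.comp hφ.tendsto_atTop))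
    subst hUeq
    refine ⟨_, h.isLimitPlane_pencil hU₁ hV₁ hc hS he (α := 1) (β := 0) (Or.inl one_ne_zero)
      (Or.inr rfl), proj_mem_points.2 (mem_span_pencil hU₁ (fun a ha => hv a (by omega))
        (mul_one _).symm ?_)⟩
    rw [mul_zero]
    exact hv _ (Nat.lt_succ_self n)

/-- The incidence set of pairs (U, v) is closed, and projecting away the compact factor `clusterSet
Γ` is a closed map. -/
lemma isClosed_limitSet
    (hL : ∃ L : Submodule ℂ (Fin (2 * n + 2) → ℂ),
      Module.finrank ℂ L = n + 1 ∧ points L ⊆ omegaSet n Γ) : IsClosed (limitSet n Γ) := by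
  rw [← isOpenQuotientMap_proj.isQuotientMap.isClosed_preimage]
  have : CompactSpace (clusterSet Γ) := isCompact_iff_compactSpace.1 isCompact_clusterSet
  set C : Set (clusterSet Γ × {v : Fin (2 * n + 2) → ℂ // v ≠ 0}) :=
    ⋂ a : Fin (2 * n + 2), ⋂ _ : n < a.val, {q | (q.1.1ᴴ *ᵥ q.2.1) a = 0}
  have hC : IsClosed C := by
    refine isClosed_iInter fun a => isClosed_iInter fun _ => isClosed_eq ?_ continuous_const
    refine (continuous_apply a).comp (Continuous.matrix_mulVec ?_ ?_)
    · exact (continuous_subtype_val.comp continuous_fst).matrix_conjTranspose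
    · exact continuous_subtype_val.comp continuous_snd
  convert! isClosedMap_snd_of_compactSpace C hC using 1
  ext v
  rw [Set.mem_preimage, proj_mem_limitSet_iff hL]
  constructor
  · rintro ⟨U, hU, hv⟩
    exact ⟨(⟨U, hU⟩, v), Set.mem_iInter₂.2 hv, rfl⟩
  · rintro ⟨⟨U, w⟩, hw, rfl⟩
    have h := Set.mem_iInter₂.1 hw
    exact ⟨U.1, U.2, h⟩

/-- Multiplication by a fixed invertible matrix keeps the limits nonzero, so renormalizing preserves
convergence. This gives the invariance of the limit set. -/
lemma IsNormalSequence.mul_left {σ : ℕ → PGLGroup (2 * n + 2)}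
    {S : Matrix (MultiIndex (n + 1) (2 * n + 2)) (MultiIndex (n + 1) (2 * n + 2)) ℂ}
    (h : IsNormalSequence n Γ σ S) {γ : PGLGroup (2 * n + 2)} (hγ : γ ∈ Γ)
    {C : Matrix (Fin (2 * n + 2)) (Fin (2 * n + 2)) ℂ} (hC : Represents C γ) :
    IsNormalSequence n Γ (fun ν => γ * σ ν) (normalized (compound (n + 1) C * S)) := by
  have hS0 := h.ne_zero
  obtain ⟨hσ, hinj, ⟨A, B, hA, hAB⟩, T, hT, hTS⟩ := h
  have hCu := hC.isUnit
  have hΛu := isUnit_compound (m := n + 1) hCu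
  have hA0 : ∀ ν, C * A ν ≠ 0 := fun ν => (hC.mul (hA ν).1).isUnit.ne_zero
  have hB0 : C * B ≠ 0 := by
    rw [Ne, hCu.mul_right_eq_zero]
    rintro rfl
    have h1 : Tendsto (fun ν => maxEntry (A ν)) atTop (𝓝 (maxEntry 0)) :=
      (continuous_maxEntry.tendsto _).comp hAB
    simp only [fun ν => (hA ν).2, maxEntry_eq_zero.2] at h1
    exact one_ne_zero (tendsto_nhds_unique tendsto_const_nhds h1)
  have hT0 : ∀ ν, compound (n + 1) C * T ν ≠ 0 := by
    intro ν
    rw [Ne, hΛu.mul_right_eq_zero]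
    intro h0
    have := (hT ν).2
    rw [h0, maxEntry_eq_zero.2 rfl] at this
    exact zero_ne_one this
  refine ⟨fun ν => Γ.mul_mem hγ (hσ ν), (mul_right_injective γ).comp hinj,
    ⟨_, _, fun ν => ⟨?_, maxEntry_normalized (hA0 ν)⟩,
      tendsto_normalized (tendsto_const_nhds.mul hAB) hB0⟩,
    ⟨_, fun ν => ⟨?_, maxEntry_normalized (hT0 ν)⟩,
      tendsto_normalized (tendsto_const_nhds.mul hTS) ?_⟩⟩
  · exact (hC.mul (hA ν).1).smul (ofReal_maxEntry_inv_ne_zero (hA0 ν))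
  · exact ((hT ν).1.mul hC).smul (ofReal_maxEntry_inv_ne_zero (hT0 ν))
  · rwa [Ne, hΛu.mul_right_eq_zero]

lemma smul_mem_limitSet {γ : PGLGroup (2 * n + 2)} (hγ : γ ∈ Γ) {p : PSpace (2 * n + 2)}
    (hp : p ∈ limitSet n Γ) : γ • p ∈ limitSet n Γ := by
  obtain ⟨v, rfl⟩ := isOpenQuotientMap_proj.surjective p
  obtain ⟨C, hC⟩ := exists_represents γ
  obtain ⟨hCv, hγv⟩ := hC.smul_proj v
  obtain ⟨L, ⟨x, σ, S, hx, rfl, h, w, hw⟩, hv⟩ := hp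
  have hinj : LinearMap.ker C.mulVecLin = ⊥ :=
    LinearMap.ker_eq_bot.2 (mulVec_injective_of_isUnit hC.isUnit)
  have hN : compound (n + 1) C * S ≠ 0 := by
    rw [Ne, (isUnit_compound hC.isUnit).mul_right_eq_zero]
    exact h.ne_zero
  rw [hγv]
  refine ⟨_, ⟨fun j => C *ᵥ x j, _, _, hx.map' C.mulVecLin hinj, rfl, h.mul_left hγ hC,
    (maxEntry (compound (n + 1) C * S) : ℂ) • w, ?_⟩, ?_⟩
  · rw [plucker_mulVec, ← hw, mulVecLin_apply, mulVecLin_apply, normalized, smul_mulVec,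
      mulVec_smul, smul_smul, inv_mul_cancel₀ (ofReal_maxEntry_ne_zero hN),
      one_smul, mulVec_mulVec]
  · refine proj_mem_points.2 ?_
    have := Submodule.mem_map_of_mem (f := C.mulVecLin) (proj_mem_points.1 hv)
    rw [Submodule.map_span, ← Set.range_comp] at this
    exact this

/-- An element with a large gap between its singular values maps every vector away from its
repelling `n`-plane close to its attracting `n`-plane. -/
lemma IsSVD.norm_mul_le {σ : PGLGroup (2 * n + 2)}
    {U V : Matrix (Fin (2 * n + 2)) (Fin (2 * n + 2)) ℂ} {d : Fin (2 * n + 2) → ℝ}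
    (h : IsSVD σ U V d) {v w : {v : Fin (2 * n + 2) → ℂ // v ≠ 0}}
    (hσ : σ • proj (2 * n + 2) v = proj (2 * n + 2) w) {i j : Fin (2 * n + 2)} (hi : i.val ≤ n)
    (hj : n < j.val) :
    ‖(V *ᵥ v.1) i * (Uᴴ *ᵥ w.1) j‖ ≤
      weight d (secondIndex n) * ‖(V *ᵥ v.1) j * (Uᴴ *ᵥ w.1) i‖ := by
  obtain ⟨h0, hv⟩ := h.represents.smul_proj v
  rw [hv] at hσ
  obtain ⟨a, ha⟩ := (Projectivization.mk_eq_mk_iff' ..).1 hσ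
  -- In singular coordinates σ is diagonal up to the scalar a; comparing two coordinates eliminates
  -- a and leaves the ratio d j / d i ≤ d_{n+1}/d_n.
  have hDV : ∀ l, (d l : ℂ) * (V *ᵥ v.1) l = a * (Uᴴ *ᵥ w.1) l := by
    intro l
    have := congrFun (congrArg (Uᴴ *ᵥ ·) ha) l
    simp only [mulVec_smul, mulVec_mulVec, ← Matrix.mul_assoc,
      conjTranspose_mul_self_of_mem h.left_mem, Matrix.one_mul] at this
    rw [← mulVec_mulVec, mulVec_diagonal, Pi.smul_apply, smul_eq_mul] at this
    exact this.symm
  have hdi : (d i : ℂ) ≠ 0 := Complex.ofReal_ne_zero.2 (h.pos i).ne'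
  have hcross : (V *ᵥ v.1) i * (Uᴴ *ᵥ w.1) j =
      ((d j / d i : ℝ) : ℂ) * ((V *ᵥ v.1) j * (Uᴴ *ᵥ w.1) i) := by
    rw [Complex.ofReal_div, div_mul_eq_mul_div, eq_div_iff hdi]
    linear_combination (Uᴴ *ᵥ w.1) j * hDV i - (Uᴴ *ᵥ w.1) i * hDV j
  rw [hcross, norm_mul, Complex.norm_real, Real.norm_of_nonneg (div_pos (h.pos _) (h.pos _)).le,
    weight_secondIndex h.pos]
  refine mul_le_mul_of_nonneg_right ?_ (norm_nonneg _)
  exact div_le_div₀ (h.pos _).le (h.antitone (Fin.le_def.2 hj)) (h.pos _)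
    (h.antitone (Fin.le_def.2 hi))

lemma tendsto_mulVec_apply {k : ℕ} {A : ℕ → Matrix (Fin k) (Fin k) ℂ}
    {A₀ : Matrix (Fin k) (Fin k) ℂ} {x : ℕ → Fin k → ℂ} {x₀ : Fin k → ℂ}
    (hA : Tendsto A atTop (𝓝 A₀)) (hx : Tendsto x atTop (𝓝 x₀)) (l : Fin k) :
    Tendsto (fun ν => (A ν *ᵥ x ν) l) atTop (𝓝 ((A₀ *ᵥ x₀) l)) := by
  have hc : Continuous fun q : Matrix (Fin k) (Fin k) ℂ × (Fin k → ℂ) => (q.1 *ᵥ q.2) l :=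
    (continuous_apply l).comp (continuous_fst.matrix_mulVec continuous_snd)
  have h := (hc.tendsto (A₀, x₀)).comp (hA.prodMk_nhds hx)
  exact h

lemma finite_of_isCompact
    (hL : ∃ L : Submodule ℂ (Fin (2 * n + 2) → ℂ),
      Module.finrank ℂ L = n + 1 ∧ points L ⊆ omegaSet n Γ)
    {M : Set (PSpace (2 * n + 2))} (hM : M ⊆ omegaSet n Γ) (hMc : IsCompact M) :
    {γ | γ ∈ Γ ∧ (((γ • ·) '' M) ∩ M).Nonempty}.Finite := by
  by_contra hinf
  obtain ⟨σ, hinj, hσ⟩ : ∃ σ : ℕ → PGLGroup (2 * n + 2), Injective σ ∧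
      ∀ ν, σ ν ∈ Γ ∧ (((σ ν • ·) '' M) ∩ M).Nonempty :=
    ⟨_, Subtype.val_injective.comp (Set.Infinite.natEmbedding _ hinf).injective,
      fun ν => (Set.Infinite.natEmbedding _ hinf ν).2⟩
  have hpair : ∀ ν, ∃ v w : Metric.sphere (0 : Fin (2 * n + 2) → ℂ) 1,
      proj _ (sphereInclusion _ v) ∈ M ∧ proj _ (sphereInclusion _ w) ∈ M ∧
      σ ν • proj _ (sphereInclusion _ v) = proj _ (sphereInclusion _ w) := by
    intro ν
    obtain ⟨_, ⟨x, hx, rfl⟩, hx'⟩ := (hσ ν).2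
    obtain ⟨v, rfl⟩ := surjective_proj_sphere x
    obtain ⟨w, hw⟩ := surjective_proj_sphere (σ ν • (proj _ ∘ sphereInclusion _) v)
    refine ⟨v, w, hx, ?_, hw.symm⟩
    have hw' : proj _ (sphereInclusion _ w) = σ ν • (proj _ ∘ sphereInclusion _) v := hw
    rw [hw']
    exact hx'
  choose v w hv hw hvw using hpair
  obtain ⟨⟨v₀, w₀⟩, χ, hχ, hlim⟩ := CompactSpace.tendsto_subseq fun ν => (v ν, w ν)
  obtain ⟨ψ, hψ, S, hS⟩ := exists_normal_subsequence (Γ := Γ) (σ := σ ∘ χ) (fun ν => (hσ _).1)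
    (hinj.comp hχ.injective)
  choose U V d hsvd using fun ν => exists_isSVD (σ ν)
  obtain ⟨φ, hφ, U₀, hU₀, V₀, hV₀, -, -, -, hU, hV, hweight, -⟩ :=
    hS.exists_rank_one_limit_svd hL fun ν => hsvd (χ (ψ ν))
  set ρ : ℕ → ℕ := fun ν => χ (ψ (φ ν))
  have hρinj : Injective (σ ∘ ρ) :=
    hinj.comp (hχ.injective.comp (hψ.injective.comp hφ.injective))
  have hU : Tendsto (fun ν => U (ρ ν)) atTop (𝓝 U₀) := hU
  have hV : Tendsto (fun ν => V (ρ ν)) atTop (𝓝 V₀) := hV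
  have hweight : Tendsto (fun ν => weight (d (ρ ν)) (secondIndex n)) atTop (𝓝 0) := hweight
  rw [nhds_prod_eq] at hlim
  have hsub := hψ.tendsto_atTop.comp hφ.tendsto_atTop
  have hvlim : Tendsto (fun ν => v (ρ ν)) atTop (𝓝 v₀) := hlim.fst.comp hsub
  have hwlim : Tendsto (fun ν => w (ρ ν)) atTop (𝓝 w₀) := hlim.snd.comp hsub
  have hv₀ : proj _ (sphereInclusion _ v₀) ∈ M := hMc.isClosed.mem_of_tendsto
    ((continuous_proj_sphere.tendsto v₀).comp hvlim) (Eventually.of_forall fun ν => hv _)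
  have hw₀ : proj _ (sphereInclusion _ w₀) ∈ M := hMc.isClosed.mem_of_tendsto
    ((continuous_proj_sphere.tendsto w₀).comp hwlim) (Eventually.of_forall fun ν => hw _)
  have hVv := fun l => tendsto_mulVec_apply hV
    (((continuous_subtype_val (p := (· ∈ Metric.sphere _ _))).tendsto v₀).comp hvlim) l
  have hUw := fun l => tendsto_mulVec_apply
    ((continuous_id.matrix_conjTranspose.tendsto U₀).comp hU)
    (((continuous_subtype_val (p := (· ∈ Metric.sphere _ _))).tendsto w₀).comp hwlim) l
  -- The weight tends to 0 while the other factor converges, so these products vanish: all (U₀ᴴw₀)_j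
  -- with j > n are 0, or all (V₀v₀)_i with i ≤ n are.
  have hzero : ∀ i j : Fin (2 * n + 2), i.val ≤ n → n < j.val →
      (V₀ *ᵥ v₀.1) i * (U₀ᴴ *ᵥ w₀.1) j = 0 := by
    intro i j hi hj
    refine norm_le_zero_iff.1 ?_
    have hle : ∀ ν, ‖(V (ρ ν) *ᵥ (v (ρ ν)).1) i * ((U (ρ ν))ᴴ *ᵥ (w (ρ ν)).1) j‖ ≤
        weight (d (ρ ν)) (secondIndex n) *
          ‖(V (ρ ν) *ᵥ (v (ρ ν)).1) j * ((U (ρ ν))ᴴ *ᵥ (w (ρ ν)).1) i‖ := fun ν =>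
      (hsvd (ρ ν)).norm_mul_le (hvw (ρ ν)) hi hj
    have hr := hweight.mul ((hVv j).mul (hUw i)).norm
    rw [zero_mul] at hr
    exact le_of_tendsto_of_tendsto' ((hVv i).mul (hUw j)).norm hr hle
  by_cases hcase : ∀ j : Fin (2 * n + 2), n < j.val → (U₀ᴴ *ᵥ w₀.1) j = 0
  · refine hM hw₀ ((proj_mem_limitSet_iff hL _).2 ⟨U₀, ?_, hcase⟩)
    exact mem_clusterSet_of_tendsto (fun ν => (hσ (ρ ν)).1) hρinj (fun ν => hsvd (ρ ν)) hU₀ hU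
  · push Not at hcase
    obtain ⟨j, hj, hne⟩ := hcase
    -- Now v₀ lies on the repelling plane, which is the attracting plane of the inverse sequence,
    -- with left factor V₀ᴴ in reversed column order.
    refine hM hv₀ ((proj_mem_limitSet_iff hL _).2 ⟨V₀ᴴ.submatrix id Fin.rev, ?_, fun a ha => ?_⟩)
    · have hcont : Continuous fun A : Matrix (Fin (2 * n + 2)) (Fin (2 * n + 2)) ℂ =>
          Aᴴ.submatrix id Fin.rev := continuous_id.matrix_conjTranspose.matrix_submatrix _ _
      have hlim' := (hcont.tendsto V₀).comp hV
      exact mem_clusterSet_of_tendsto (σ := fun ν => (σ (ρ ν))⁻¹)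
        (fun ν => Γ.inv_mem (hσ (ρ ν)).1) (inv_injective.comp hρinj)
        (fun ν => (hsvd (ρ ν)).inv)
        (isCompact_unitaryGroup.isClosed.mem_of_tendsto hlim'
          (Eventually.of_forall fun ν => (hsvd (ρ ν)).inv.left_mem)) hlim'
    · have : ((V₀ᴴ.submatrix id Fin.rev)ᴴ *ᵥ v₀.1) a = (V₀ *ᵥ v₀.1) a.rev := by
        rw [conjTranspose_submatrix, conjTranspose_conjTranspose]
        rfl
      refine this.trans ((mul_eq_zero.1 (hzero a.rev j ?_ hj)).resolve_right hne)
      rw [Fin.val_rev]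
      omega

theorem actsProperlyDiscontinuouslyOn_omegaSet
    (hL : ∃ L : Submodule ℂ (Fin (2 * n + 2) → ℂ),
      Module.finrank ℂ L = n + 1 ∧ points L ⊆ omegaSet n Γ) :
    ActsProperlyDiscontinuouslyOn Γ (omegaSet n Γ) := by
  refine ⟨fun γ hγ x hx hγx => hx ?_, fun M hM hMc => finite_of_isCompact hL hM hMc⟩
  have := smul_mem_limitSet (Γ.inv_mem hγ) hγx
  rwa [inv_smul_smul] at this

end TypeL
end

theorem theorem3p6 (n : ℕ) (hn : 1 ≤ n) (Γ : Subgroup (TypeL.PGLGroup (2 * n + 2)))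
    (hΓ : TypeL.IsTypeL n Γ) :
    IsOpen (TypeL.omegaSet n Γ) ∧
      TypeL.ActsProperlyDiscontinuouslyOn Γ (TypeL.omegaSet n Γ) ∧
      T2Space (TypeL.XSpace n Γ) ∧
      LocallyCompactSpace (TypeL.XSpace n Γ) ∧
      SecondCountableTopology (TypeL.XSpace n Γ) ∧
      TypeL.HasFiniteSlices Γ (TypeL.omegaSet n Γ) := by
  obtain ⟨-, W, ⟨-, -, L, hdim, hLW⟩, hW⟩ := hΓ
  have hL : ∃ L : Submodule ℂ (Fin (2 * n + 2) → ℂ),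
      Module.finrank ℂ L = n + 1 ∧ TypeL.points L ⊆ TypeL.omegaSet n Γ :=
    ⟨L, hdim, hLW.trans hW⟩
  have hopen : IsOpen (TypeL.omegaSet n Γ) := (TypeL.isClosed_limitSet hL).isOpen_compl
  have hact := TypeL.actsProperlyDiscontinuouslyOn_omegaSet hL
  obtain ⟨h1, h2, h3⟩ := hact.quotient hopen
  exact ⟨hopen, hact, h1, h2, h3, hact.hasFiniteSlices hopen⟩
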